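/- Let $1\le p<\infty$ and $a>0$, and let $\varphi:(0,\infty)\to\mathbb{C}$ be a measurable function with $$\int_0^\infty|\varphi(t)|\,t^{\frac{a+1}{p}-1}\,dt<\infty .$$ Let $\mathbb{U}=\{z=x+iy\in\mathbb{C}: y>0\}$ and $dA_a(z)=y^{a-1}\,dx\,dy$, let $L^p_a(\mathbb{U})=L^p(\mathbb{U},dA_a)$, and let the weighted Bergman space $A^p_a(\mathbb{U})$ be the space of all holomorphic functions $f$ on $\mathbb{U}$ with $$\|f\|_{A^p_a}=\Big(\int_{\mathbb{U}}|f(z)|^p\,dA_a(z)\Big)^{1/p}<\infty .$$ Let $$\mathcal{H}_\varphi f(z)=\int_0^\infty f\Big(\frac{z}{t}\Big)\frac{\varphi(t)}{t}\,dt$$ be the Hausdorff operator with kernel $\varphi$, and for $\xi\in\mathbb{R}$ let $$\widehat{k_{a,p}}(\xi)=\int_0^\infty\varphi(t)\,t^{\frac{a+1}{p}}\,\frac{dt}{t^{1+i\xi}} .$$ Then $\mathcal{H}_\varphi$ is a well-defined bounded linear operator on $A^p_a(\mathbb{U})$ (the integral converges absolutely for every $f\in A^p_a(\mathbb{U})$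 and every $z\in\mathbb{U}$) and on $L^p_a(\mathbb{U})$ (the integral converges absolutely for every $f\in L^p_a(\mathbb{U})$ and almost every $z\in\mathbb{U}$), and its spectrum on each of these spaces is the closure of the range of $\widehat{k_{a,p}}$: $$\sigma(\mathcal{H}_\varphi,A^p_a(\mathbb{U}))=\sigma(\mathcal{H}_\varphi,L^p_a(\mathbb{U}))=\overline{\widehat{k_{a,p}}(\mathbb{R})} ,$$ where $\sigma(\mathcal{H}_\varphi,X)$ is the set of all $\lambda\in\mathbb{C}$ for which $\lambda I-\mathcal{H}_\varphi$ has no bounded inverse on $X$. -/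

import Mathlib

open MeasureTheory Set

noncomputable section

namespace HausdorffBergman

/-- The open upper half-plane, as a subset of the complex plane. -/
def upperHalfPlane : Set ℂ := {z : ℂ | 0 < z.im}

theorem isOpen_upperHalfPlane : IsOpen upperHalfPlane :=
  isOpen_lt continuous_const Complex.continuous_im

/-- The measure `dA_a(z) = y ^ (a - 1) dx dy`, `z = x + i y`, on the upper half-plane
(a measure on the complex plane that gives mass zero to the complement of the half-plane). -/
def areaMeasure (a : ℝ) : Measure ℂ :=
  (volume.restrict upperHalfPlane).withDensity (fun z => ENNReal.ofReal (z.im ^ (a - 1)))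

instance factOneLeOfReal (p : ℝ) [hp : Fact (1 ≤ p)] : Fact (1 ≤ ENNReal.ofReal p) :=
  ⟨by simpa using ENNReal.ofReal_le_ofReal hp.out⟩

/-- The space `L^p_a` of the upper half-plane. -/
abbrev LebesgueSpace (a p : ℝ) : Type := Lp ℂ (ENNReal.ofReal p) (areaMeasure a)

/-- The holomorphic functions on the upper half-plane whose `p`-th power is integrable with
respect to `dA_a`. A function on the half-plane is represented by its extension by zero to the
complex plane, so that two elements are equal exactly if they agree on the half-plane. -/
def bergmanSubmodule (a p : ℝ) : Submodule ℂ (ℂ → ℂ) where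
  carrier := {f | DifferentiableOn ℂ f upperHalfPlane ∧ (∀ z, z ∉ upperHalfPlane → f z = 0) ∧
    MemLp f (ENNReal.ofReal p) (areaMeasure a)}
  add_mem' := by
    rintro f g ⟨hf, hf0, hfm⟩ ⟨hg, hg0, hgm⟩
    exact ⟨hf.add hg, fun z hz => by simp [hf0 z hz, hg0 z hz], hfm.add hgm⟩
  zero_mem' := ⟨differentiableOn_const 0, fun _ _ => rfl, MemLp.zero⟩
  smul_mem' := by
    rintro c f ⟨hf, hf0, hfm⟩
    exact ⟨hf.const_smul c, fun z hz => by simp [hf0 z hz], hfm.const_smul c⟩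

/-- The weighted Bergman space `A^p_a` of the upper half-plane. It is a type of its own, and not
a subtype of the functions, so that it carries the topology of its norm and not that of pointwise
convergence. -/
def BergmanSpace (a p : ℝ) : Type := bergmanSubmodule a p

namespace BergmanSpace

instance (a p : ℝ) : AddCommGroup (BergmanSpace a p) :=
  inferInstanceAs (AddCommGroup (bergmanSubmodule a p))

instance (a p : ℝ) : Module ℂ (BergmanSpace a p) :=
  inferInstanceAs (Module ℂ (bergmanSubmodule a p))

/-- The function underlying an element of the Bergman space. -/
def toFun {a p : ℝ} (f : BergmanSpace a p) : ℂ → ℂ := f.1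

instance (a p : ℝ) : CoeFun (BergmanSpace a p) (fun _ => ℂ → ℂ) := ⟨toFun⟩

/-- `‖f‖ = (∫ |f|^p dA_a)^(1/p)`. -/
instance (a p : ℝ) : Norm (BergmanSpace a p) :=
  ⟨fun f => (∫ z, ‖f z‖ ^ p ∂(areaMeasure a)) ^ (1 / p)⟩

theorem norm_def {a p : ℝ} (f : BergmanSpace a p) :
    ‖f‖ = (∫ z, ‖f z‖ ^ p ∂(areaMeasure a)) ^ (1 / p) := rfl

theorem memLp {a p : ℝ} (f : BergmanSpace a p) :
    MemLp (f : ℂ → ℂ) (ENNReal.ofReal p) (areaMeasure a) := f.2.2.2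

theorem norm_eq {a p : ℝ} [hp : Fact (1 ≤ p)] (f : BergmanSpace a p) :
    ‖f‖ = (eLpNorm (f : ℂ → ℂ) (ENNReal.ofReal p) (areaMeasure a)).toReal := by
  have h1 : (1 : ℝ) ≤ p := hp.out
  have h0 : (0 : ℝ) ≤ p := by linarith
  rw [norm_def, f.memLp.eLpNorm_eq_integral_rpow_norm
    (by simpa using (by linarith : 0 < p)) ENNReal.ofReal_ne_top, ENNReal.toReal_ofReal h0,
    ENNReal.toReal_ofReal (Real.rpow_nonneg (integral_nonneg fun z => by positivity) _),
    one_div]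

theorem eq_zero_of_ae {a p : ℝ} (f : BergmanSpace a p)
    (h : (f : ℂ → ℂ) =ᵐ[areaMeasure a] 0) : f = 0 := by
  have hm : Measurable fun z : ℂ => ENNReal.ofReal (z.im ^ (a - 1)) := by fun_prop
  have h' : (f : ℂ → ℂ) =ᵐ[volume.restrict upperHalfPlane] 0 := by
    have h2 := (ae_withDensity_iff hm).1 h
    filter_upwards [h2, ae_restrict_mem isOpen_upperHalfPlane.measurableSet] with z hz hzU
    refine hz ?_
    have : 0 < z.im ^ (a - 1) := Real.rpow_pos_of_pos hzU _
    simpa using this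
  have h3 : EqOn (f : ℂ → ℂ) 0 upperHalfPlane :=
    Measure.eqOn_open_of_ae_eq h' isOpen_upperHalfPlane f.2.1.continuousOn continuousOn_const
  refine Subtype.ext (funext fun z => ?_)
  by_cases hz : z ∈ upperHalfPlane
  · exact h3 hz
  · exact f.2.2.1 z hz

theorem normCore (a p : ℝ) [hp : Fact (1 ≤ p)] : NormedSpace.Core ℂ (BergmanSpace a p) where
  norm_nonneg f := by rw [norm_eq]; exact ENNReal.toReal_nonneg
  norm_smul c f := by
    rw [norm_eq, norm_eq]
    have : ((c • f : BergmanSpace a p) : ℂ → ℂ) = c • (f : ℂ → ℂ) := rfl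
    rw [this, eLpNorm_const_smul, ENNReal.toReal_mul]
    simp
  norm_triangle f g := by
    rw [norm_eq, norm_eq, norm_eq,
      ← ENNReal.toReal_add f.memLp.eLpNorm_ne_top g.memLp.eLpNorm_ne_top]
    refine ENNReal.toReal_mono
      (ENNReal.add_ne_top.2 ⟨f.memLp.eLpNorm_ne_top, g.memLp.eLpNorm_ne_top⟩) ?_
    exact eLpNorm_add_le f.memLp.1 g.memLp.1 (factOneLeOfReal p).out
  norm_eq_zero_iff f := by
    have hp1 : (1 : ℝ) ≤ p := hp.out
    have hp0 : ENNReal.ofReal p ≠ 0 := by simpa using (by linarith : 0 < p)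
    rw [norm_eq, ENNReal.toReal_eq_zero_iff, or_iff_left f.memLp.eLpNorm_ne_top,
      eLpNorm_eq_zero_iff f.memLp.1 hp0]
    refine ⟨f.eq_zero_of_ae, ?_⟩
    rintro rfl
    exact Filter.EventuallyEq.rfl

instance (a p : ℝ) [Fact (1 ≤ p)] : NormedAddCommGroup (BergmanSpace a p) :=
  NormedAddCommGroup.ofCore (normCore a p)

instance (a p : ℝ) [Fact (1 ≤ p)] : NormedSpace ℂ (BergmanSpace a p) :=
  NormedSpace.ofCore (normCore a p)

end BergmanSpace

/-- The integrand `t ↦ f (z / t) φ(t) / t` of the Hausdorff operator. -/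
def hausdorffIntegrand (φ : ℝ → ℂ) (f : ℂ → ℂ) (z : ℂ) (t : ℝ) : ℂ :=
  f (z / (t : ℂ)) * (φ t / (t : ℂ))

/-- `T` is the Hausdorff operator with kernel `φ` on the Bergman space: at every point of the
half-plane the defining integral converges absolutely, and its value is that of `T f`. -/
def IsHausdorffOnBergman {a p : ℝ} [Fact (1 ≤ p)] (φ : ℝ → ℂ)
    (T : BergmanSpace a p →L[ℂ] BergmanSpace a p) : Prop :=
  ∀ f : BergmanSpace a p, ∀ z ∈ upperHalfPlane,
    IntegrableOn (hausdorffIntegrand φ f z) (Ioi 0) ∧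
      T f z = ∫ t in Ioi 0, hausdorffIntegrand φ f z t

/-- `T` is the Hausdorff operator with kernel `φ` on `L^p_a`: at almost every point of the
half-plane the defining integral converges absolutely, and its value is that of `T f`. -/
def IsHausdorffOnLebesgue {a p : ℝ} [Fact (1 ≤ p)] (φ : ℝ → ℂ)
    (T : LebesgueSpace a p →L[ℂ] LebesgueSpace a p) : Prop :=
  ∀ f : LebesgueSpace a p, ∀ᵐ z ∂(areaMeasure a),
    IntegrableOn (hausdorffIntegrand φ f z) (Ioi 0) ∧
      T f z = ∫ t in Ioi 0, hausdorffIntegrand φ f z t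

/-- `ξ ↦ ∫_0^∞ φ(t) t^((a+1)/p) dt / t^(1+iξ)`. -/
def kernelTransform (φ : ℝ → ℂ) (a p : ℝ) (ξ : ℝ) : ℂ :=
  ∫ t in Ioi (0 : ℝ), φ t * ((t ^ ((a + 1) / p) : ℝ) : ℂ) / (t : ℂ) ^ (1 + Complex.I * (ξ : ℂ))

end HausdorffBergman

end

/-! The substitution t = e^s turns the Hausdorff operator into T = ∫ k(s) U_s ds. Here U_s f(z) =
e^{-s(a+1)/p} f(e^{-s} z) is a group of isometries of both spaces, k(s) = φ(e^s) e^{s(a+1)/p} is in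
L¹(ℝ) by the hypothesis on φ, and the kernel transform is the Fourier transform k̂(ξ) = ∫ k(s)
e^{-iξs} ds. The theorem then reads σ(T) = closure of k̂(ℝ).

Upper inclusion (`spectrum_average_subset`), for any contraction group. The value 0 lies in the
closure by Riemann–Lebesgue. A spectral value μ ≠ 0 is χ(T) for a character χ of a commutative
Banach algebra containing T and all U_s. The group need not be norm continuous, but s ↦ U_s T is,
because translation is continuous in L¹. Hence χ(U_s) = χ(U_s T)/μ is a continuous bounded character
of ℝ, that is e^{-iξs}, and applying χ to T² = ∫ k(s) U_s T ds gives μ = k̂(ξ).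

Lower inclusion (`spectrum_average_eq`, `exists_approximate_eigenvectors`). The power z^{-(a+1)/p +
iξ} satisfies U_s f = e^{-iξs} f but has infinite norm. The factor (z/(z+i)²)^ε makes it
p-integrable and, as ε → 0, spoils the eigenvalue equation only by a relative error O(ε).
Normalized, these functions are approximate eigenvectors of T for k̂(ξ). They are holomorphic, so
they serve both spaces through the isometric inclusion of A^p_a in L^p_a.

The vector-valued integral agrees with the pointwise one by continuity of point evaluations on
A^p_a, and by Fubini on sets of finite measure on L^p_a. -/

noncomputable section
namespace HausdorffBergman
open Filter Topology

/-! ### Characters of the real line and translation in L¹ -/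

/-- A continuous bounded character of the additive group of reals is an exponential. -/
theorem exists_eq_exp_of_bounded_character {u : ℝ → ℂ} (hc : Continuous u) (h0 : u 0 = 1)
    (hadd : ∀ s t, u (s + t) = u s * u t) (hb : ∀ s, ‖u s‖ ≤ 1) :
    ∃ ξ : ℝ, ∀ s, u s = Complex.exp (-Complex.I * ξ * s) := by
  -- Averaging smooths u: u(s) ∫_0^c u = ∫_s^{s+c} u, and the right side is differentiable in s. A c
  -- with nonvanishing integral exists, since c ↦ ∫_0^c u has derivative u(0) = 1 at 0.
  have hI : ∃ c : ℝ, ∫ t in (0 : ℝ)..c, u t ≠ 0 := by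
    by_contra! h
    have h1 : HasDerivAt (fun c => ∫ t in (0 : ℝ)..c, u t) (u 0) 0 :=
      intervalIntegral.integral_hasDerivAt_right (hc.intervalIntegrable _ _)
        (hc.stronglyMeasurableAtFilter _ _) hc.continuousAt
    have h2 : (fun c => ∫ t in (0 : ℝ)..c, u t) = fun _ => 0 := funext h
    rw [h2] at h1
    have := h1.unique (hasDerivAt_const _ _)
    rw [h0] at this
    exact one_ne_zero this
  obtain ⟨c, hcI⟩ := hI
  set J := ∫ t in (0 : ℝ)..c, u t with hJ
  have hrep : ∀ s, u s = (∫ t in s..(s + c), u t) / J := by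
    intro s
    rw [eq_div_iff hcI, hJ, ← intervalIntegral.integral_const_mul]
    simp_rw [← hadd]
    rw [intervalIntegral.integral_comp_add_left (fun x => u x) s]
    simp
  have hdiff : DifferentiableAt ℝ u 0 := by
    have hF : ∀ x, HasDerivAt (fun c => ∫ t in (0 : ℝ)..c, u t) (u x) x := fun x =>
      intervalIntegral.integral_hasDerivAt_right (hc.intervalIntegrable _ _)
        (hc.stronglyMeasurableAtFilter _ _) hc.continuousAt
    have h3 : u = fun s => ((∫ t in (0 : ℝ)..(s + c), u t) - ∫ t in (0 : ℝ)..s, u t) / J := by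
      funext s
      rw [hrep s, intervalIntegral.integral_interval_sub_left (hc.intervalIntegrable _ _)
        (hc.intervalIntegrable _ _)]
    rw [h3]
    have h4 : HasDerivAt (fun s => ∫ t in (0 : ℝ)..(s + c), u t) (u (0 + c)) 0 :=
      (hF (0 + c)).comp_add_const 0 c
    exact ((h4.sub (hF 0)).div_const J).differentiableAt
  set α := deriv u 0 with hα
  have hder : ∀ s, HasDerivAt u (α * u s) s := by
    intro s
    have h5 : u = fun t => u s * u (t - s) := by
      funext t; rw [← hadd]; congr 1; ring
    have h6 : HasDerivAt u α (s - s) := by rw [sub_self]; exact hdiff.hasDerivAt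
    have h7 := (h6.comp_sub_const s s).const_mul (u s)
    rw [← h5, mul_comm] at h7
    exact h7
  have hexp : ∀ s : ℝ, u s = Complex.exp (α * s) := by
    have h8 : ∀ s : ℝ, HasDerivAt (fun s : ℝ => u s * Complex.exp (-(α * s))) 0 s := by
      intro s
      have h9 : HasDerivAt (fun s : ℝ => Complex.exp (-(α * s)))
          (Complex.exp (-(α * s)) * -(α * 1)) s :=
        (((Complex.ofRealCLM.hasDerivAt (x := s)).const_mul α).neg).cexp
      have := (hder s).mul h9
      have h0' : α * u s * Complex.exp (-(α * s)) + u s * (Complex.exp (-(α * s)) * -(α * 1)) = 0 := by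
        ring
      rw [h0'] at this
      exact this
    intro s
    have h10 := is_const_of_deriv_eq_zero (fun s => (h8 s).differentiableAt)
      (fun s => (h8 s).deriv) s 0
    simp only [h0, Complex.ofReal_zero, mul_zero, neg_zero, Complex.exp_zero, mul_one] at h10
    rw [Complex.exp_neg, mul_inv_eq_iff_eq_mul₀ (Complex.exp_ne_zero _), one_mul] at h10
    exact h10
  -- Boundedness at both s = 1 and s = -1 leaves no real part in the exponent.
  have hre : α.re = 0 := by
    have h11 : ∀ s : ℝ, α.re * s ≤ 0 := by
      intro s
      have := hb s
      rw [hexp, Complex.norm_exp] at this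
      simpa using this
    have := h11 1
    have := h11 (-1)
    linarith
  refine ⟨-α.im, fun s => ?_⟩
  rw [hexp]
  congr 1
  apply Complex.ext <;> simp [hre]

/-- Translation is continuous in `L¹`. -/
theorem tendsto_integral_norm_translate_sub {k : ℝ → ℂ} (hk : Integrable k) (s₀ : ℝ) :
    Tendsto (fun s => ∫ r, ‖k (r - s) - k (r - s₀)‖) (𝓝 s₀) (𝓝 0) := by
  have : Fact ((1 : ENNReal) ≠ ⊤) := ⟨ENNReal.one_ne_top⟩
  let g : Lp ℂ 1 (volume : Measure ℝ) := hk.toL1 k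
  have hcont : Continuous fun s : ℝ => DomAddAct.mk (-s) +ᵥ g :=
    (DomAddAct.continuous_mk.comp continuous_neg).vadd continuous_const
  have h1 := tendsto_iff_norm_sub_tendsto_zero.1 (hcont.tendsto s₀)
  refine h1.congr fun s => ?_
  rw [L1.norm_eq_integral_norm]
  refine integral_congr_ae ?_
  have hg : ∀ s : ℝ, (DomAddAct.mk (-s) +ᵥ g : Lp ℂ 1 (volume : Measure ℝ))
      =ᵐ[volume] fun r => k (r - s) := by
    intro s
    refine (Lp.coeFn_compMeasurePreserving g (measurePreserving_vadd (-s) volume)).trans ?_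
    have := (measurePreserving_vadd (-s) (volume : Measure ℝ)).quasiMeasurePreserving.ae_eq_comp
      hk.coeFn_toL1
    refine this.trans (Eventually.of_forall fun r => ?_)
    simp [sub_eq_neg_add]
  filter_upwards [Lp.coeFn_sub (DomAddAct.mk (-s) +ᵥ g : Lp ℂ 1 (volume : Measure ℝ))
    (DomAddAct.mk (-s₀) +ᵥ g), hg s, hg s₀] with r h2 h3 h4
  rw [h2, Pi.sub_apply, h3, h4]

/-! ### Contraction groups and multiplicative functionals -/

variable {X : Type*} [NormedAddCommGroup X] [NormedSpace ℂ X]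

/-- A one-parameter group of contractions (hence isometries), measurable in the strong sense. -/
structure IsContractionGroup (U : ℝ → X →L[ℂ] X) : Prop where
  map_zero : U 0 = 1
  map_add : ∀ s t, U (s + t) = U s * U t
  norm_apply_le : ∀ s x, ‖U s x‖ ≤ ‖x‖
  stronglyMeasurable : ∀ x, StronglyMeasurable fun s => U s x

/-- Points of the spectrum are values of a functional that is multiplicative on a subalgebra
containing a given commuting set. -/
theorem exists_multiplicative_functional {A : Type*} [NormedRing A] [NormedAlgebra ℂ A]
    [CompleteSpace A] {S : Set A} (hS : ∀ x ∈ S, ∀ y ∈ S, x * y = y * x) {T : A} (hT : T ∈ S)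
    {μ : ℂ} (hμ : μ ∈ spectrum ℂ T) :
    ∃ (C : Subalgebra ℂ A) (L : A →L[ℂ] ℂ), S ⊆ C ∧ L T = μ ∧ L 1 = 1 ∧
      (∀ x ∈ C, ∀ y ∈ C, L (x * y) = L x * L y) ∧ ∀ x ∈ C, ‖L x‖ ≤ ‖x‖ * ‖(1 : A)‖ := by
  let C : Subalgebra ℂ A := (Algebra.adjoin ℂ S).topologicalClosure
  have hSC : ∀ x ∈ S, x ∈ C := fun x hx =>
    Subalgebra.le_topologicalClosure _ (Algebra.subset_adjoin hx)
  have hC : IsClosed (C : Set A) := Subalgebra.isClosed_topologicalClosure _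
  have hcomm : ∀ x y : C, x * y = y * x := by
    have h0 : ∀ x y : Algebra.adjoin ℂ S, x * y = y * x :=
      (Algebra.isMulCommutative_adjoin ℂ hS).is_comm.comm
    let _ := (Algebra.adjoin ℂ S).commRingTopologicalClosure h0
    exact fun x y => mul_comm x y
  let _ : NormedCommRing C := { (inferInstance : NormedRing C) with mul_comm := hcomm }
  let _ : NormedAlgebra ℂ C := { (inferInstance : Algebra ℂ C) with
    norm_smul_le := fun r x => norm_smul_le r (x : A) }
  have : CompleteSpace C := hC.completeSpace_coe
  -- An inverse in C would also be an inverse in A, so non-invertibility descends to C, where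
  -- Gelfand theory gives a character vanishing on μ - T.
  have hunit : ¬ IsUnit (algebraMap ℂ C μ - ⟨T, hSC T hT⟩) := by
    intro h
    exact hμ (h.map C.val)
  obtain ⟨χ, hχ⟩ := WeakDual.CharacterSpace.exists_apply_eq_zero hunit
  let χ' : C →ₐ[ℂ] ℂ := WeakDual.CharacterSpace.toAlgHom χ
  have hb : ∀ x : C, ‖χ' x‖ ≤ ‖(x : A)‖ * ‖(1 : A)‖ := AlgHom.norm_apply_le_self_mul_norm_one χ'
  have hχT : χ' ⟨T, hSC T hT⟩ = μ := by
    have h1 : χ' (algebraMap ℂ C μ - ⟨T, hSC T hT⟩) = 0 := hχ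
    rw [map_sub, AlgHom.commutes, sub_eq_zero] at h1
    exact h1.symm
  -- Hahn–Banach extends the character to all of A, so that it can be applied to integrals formed in
  -- A. The factor ‖1‖ stays in the bounds because ‖1‖ = 1 is not assumed.
  let L₀ : C.toSubmodule →L[ℂ] ℂ := LinearMap.mkContinuous (E := C.toSubmodule)
    { toFun := fun x => χ' x, map_add' := fun x y => map_add χ' x y,
      map_smul' := fun c x => map_smul χ' c x } ‖(1 : A)‖
    fun x => by rw [mul_comm]; exact hb x
  obtain ⟨L, hL, -⟩ := exists_extension_norm_eq C.toSubmodule L₀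
  have hL' : ∀ x : C, L x = χ' x := hL
  refine ⟨C, L, hSC, (hL' ⟨T, hSC T hT⟩).trans hχT, (hL' 1).trans (map_one χ'),
    fun x hx y hy => ?_, fun x hx => ?_⟩
  · rw [hL' ⟨x, hx⟩, hL' ⟨y, hy⟩, ← map_mul]
    exact hL' (⟨x, hx⟩ * ⟨y, hy⟩)
  · rw [hL' ⟨x, hx⟩]
    exact hb ⟨x, hx⟩

/-! ### The spectrum of an average over a contraction group -/

namespace IsContractionGroup

variable {U : ℝ → X →L[ℂ] X} {k : ℝ → ℂ}

theorem integrable_smul (hU : IsContractionGroup U) (hk : Integrable k) (x : X) :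
    Integrable fun s => k s • U s x := by
  refine (hk.norm.mul_const ‖x‖).mono'
    (hk.aestronglyMeasurable.smul (hU.stronglyMeasurable x).aestronglyMeasurable)
    (Eventually.of_forall fun s => ?_)
  rw [norm_smul]
  gcongr
  exact hU.norm_apply_le s x

theorem norm_integral_smul_le (hU : IsContractionGroup U) (hk : Integrable k) (x : X) :
    ‖∫ s, k s • U s x‖ ≤ (∫ s, ‖k s‖) * ‖x‖ := by
  rw [← integral_mul_const]
  refine norm_integral_le_of_norm_le (hk.norm.mul_const ‖x‖) (Eventually.of_forall fun s => ?_)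
  rw [norm_smul]
  gcongr
  exact hU.norm_apply_le s x

/-- The operator `∫ k(s) U_s ds`. -/
def average (hU : IsContractionGroup U) (hk : Integrable k) : X →L[ℂ] X :=
  LinearMap.mkContinuous
    { toFun := fun x => ∫ s, k s • U s x
      map_add' := fun x y => by
        rw [← integral_add (hU.integrable_smul hk x) (hU.integrable_smul hk y)]
        refine integral_congr_ae (Eventually.of_forall fun s => ?_)
        simp only [ContinuousLinearMap.map_add, smul_add]
      map_smul' := fun c x => by
        rw [RingHom.id_apply, ← integral_smul]
        refine integral_congr_ae (Eventually.of_forall fun s => ?_)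
        simp only [ContinuousLinearMap.map_smul, smul_comm (k s) c] }
    (∫ s, ‖k s‖) (hU.norm_integral_smul_le hk)

theorem average_apply (hU : IsContractionGroup U) (hk : Integrable k) (x : X) :
    hU.average hk x = ∫ s, k s • U s x := rfl

theorem commute (hU : IsContractionGroup U) (s t : ℝ) : U s * U t = U t * U s := by
  rw [← hU.map_add, ← hU.map_add, add_comm]

theorem norm_map_le (hU : IsContractionGroup U) (s : ℝ) : ‖U s‖ ≤ 1 :=
  ContinuousLinearMap.opNorm_le_bound _ zero_le_one fun x => by
    rw [one_mul]; exact hU.norm_apply_le s x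

variable [CompleteSpace X]

theorem map_average_apply {E : Type*} [NormedAddCommGroup E] [NormedSpace ℂ E] [CompleteSpace E]
    (L : X →L[ℂ] E) (hU : IsContractionGroup U) (hk : Integrable k) (x : X) :
    L (hU.average hk x) = ∫ s, k s • L (U s x) := by
  rw [average_apply, ← L.integral_comp_comm (hU.integrable_smul hk x)]
  simp only [ContinuousLinearMap.map_smul]

theorem apply_average (hU : IsContractionGroup U) (hk : Integrable k) (s : ℝ) (x : X) :
    U s (hU.average hk x) = ∫ r, k (r - s) • U r x := by
  rw [map_average_apply, ← integral_add_right_eq_self (fun r => k (r - s) • U r x) s]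
  refine integral_congr_ae (Eventually.of_forall fun r => ?_)
  simp only [add_sub_cancel_right]
  rw [add_comm r s, hU.map_add s r]
  rfl

theorem commute_average (hU : IsContractionGroup U) (hk : Integrable k) (s : ℝ) :
    U s * hU.average hk = hU.average hk * U s := by
  ext x
  change U s (hU.average hk x) = hU.average hk (U s x)
  rw [map_average_apply, average_apply]
  refine integral_congr_ae (Eventually.of_forall fun r => congrArg (k r • ·) ?_)
  exact DFunLike.congr_fun (hU.commute s r) x

/-- U_s T averages the group against the translate k(· - s), so ‖U_s T - U_{s₀} T‖ is at most the L¹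
distance of two translates of k. -/
theorem continuous_mul_average (hU : IsContractionGroup U) (hk : Integrable k) :
    Continuous fun s => U s * hU.average hk := by
  refine continuous_iff_continuousAt.2 fun s₀ => tendsto_iff_norm_sub_tendsto_zero.2 ?_
  refine squeeze_zero (fun _ => norm_nonneg _) (fun s => ?_)
    (tendsto_integral_norm_translate_sub hk s₀)
  refine ContinuousLinearMap.opNorm_le_bound _ (integral_nonneg fun _ => norm_nonneg _) fun x => ?_
  have h1 : (U s * hU.average hk - U s₀ * hU.average hk) x
      = ∫ r, (k (r - s) - k (r - s₀)) • U r x := by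
    change U s (hU.average hk x) - U s₀ (hU.average hk x) = _
    rw [hU.apply_average, hU.apply_average, ← integral_sub
      (hU.integrable_smul (hk.comp_sub_right s) x) (hU.integrable_smul (hk.comp_sub_right s₀) x)]
    simp_rw [sub_smul]
  rw [h1]
  exact hU.norm_integral_smul_le ((hk.comp_sub_right s).sub (hk.comp_sub_right s₀)) x

/-- Riemann–Lebesgue: the transform tends to 0 at infinity. The frequency is rescaled by (2π)⁻¹ to
match `Real.fourierChar`. -/
theorem zero_mem_closure_range_fourier (k : ℝ → ℂ) :
    (0 : ℂ) ∈ closure (range fun ξ : ℝ => ∫ s, k s * Complex.exp (-Complex.I * ξ * s)) := by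
  have h := Real.tendsto_integral_exp_smul_cocompact k
  have hc : Tendsto (fun ξ : ℝ => ∫ s, k s * Complex.exp (-Complex.I * ξ * s)) (cocompact ℝ)
      (𝓝 0) := by
    have hπ : (2 * Real.pi)⁻¹ ≠ 0 := by positivity
    have h2 := h.comp ((Homeomorph.mulLeft₀ _ hπ).isClosedEmbedding.tendsto_cocompact)
    refine h2.congr fun ξ => ?_
    refine integral_congr_ae (Eventually.of_forall fun s => ?_)
    simp only [Real.fourierChar, Circle.smul_def, smul_eq_mul, Homeomorph.coe_mulLeft₀]
    rw [mul_comm (k s)]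
    congr 1
    change Complex.exp _ = _
    congr 1
    push_cast
    field_simp
  exact mem_closure_of_tendsto hc (Eventually.of_forall fun ξ => ⟨ξ, rfl⟩)

theorem spectrum_average_subset (hU : IsContractionGroup U) (hk : Integrable k) :
    spectrum ℂ (hU.average hk) ⊆
      closure (range fun ξ : ℝ => ∫ s, k s * Complex.exp (-Complex.I * ξ * s)) := by
  intro μ hμ
  rcases eq_or_ne μ 0 with rfl | hμ0
  · exact zero_mem_closure_range_fourier k
  set T := hU.average hk with hT
  have hS : ∀ x ∈ insert T (range U), ∀ y ∈ insert T (range U), x * y = y * x := by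
    rintro x (rfl | ⟨s, rfl⟩) y (rfl | ⟨t, rfl⟩)
    · rfl
    · exact (hU.commute_average hk t).symm
    · exact hU.commute_average hk s
    · exact hU.commute s t
  obtain ⟨C, L, hSC, hLT, hL1, hLmul, hLle⟩ :=
    exists_multiplicative_functional hS (mem_insert _ _) hμ
  have hTC : T ∈ C := hSC (mem_insert _ _)
  have hUC : ∀ s, U s ∈ C := fun s => hSC (mem_insert_of_mem _ ⟨s, rfl⟩)
  have hF := hU.continuous_mul_average hk
  have hLUT : ∀ s, L (U s * T) = L (U s) * μ := fun s => by rw [hLmul _ (hUC s) _ hTC, hLT]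
  obtain ⟨ξ, hξ⟩ := exists_eq_exp_of_bounded_character (u := fun s => L (U s))
    (by
      have h1 : (fun s => L (U s)) = fun s => L (U s * T) / μ := by
        funext s
        rw [hLUT, mul_div_cancel_right₀ _ hμ0]
      rw [h1]
      exact (L.continuous.comp hF).div_const μ)
    (by simp only [hU.map_zero, hL1])
    (fun s t => by simp only [hU.map_add, hLmul _ (hUC s) _ (hUC t)])
    (fun s => (hLle _ (hUC s)).trans
      (mul_le_one₀ (hU.norm_map_le s) (norm_nonneg _) ContinuousLinearMap.norm_id_le))
  refine subset_closure ⟨ξ, ?_⟩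
  have hint : Integrable fun s => k s • (U s * T) := by
    refine (hk.norm.mul_const ‖T‖).mono'
      (hk.aestronglyMeasurable.smul hF.aestronglyMeasurable) (Eventually.of_forall fun s => ?_)
    rw [norm_smul]
    gcongr
    refine (norm_mul_le _ _).trans (mul_le_of_le_one_left (norm_nonneg _) (hU.norm_map_le s))
  -- The integral converges in operator norm because s ↦ U_s T is norm continuous, so L may be taken
  -- inside. This yields μ² = k̂(ξ) μ.
  have hTT : ∫ s, k s • (U s * T) = T * T := by
    refine ContinuousLinearMap.ext fun x => ?_
    rw [ContinuousLinearMap.integral_apply hint]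
    rfl
  have h2 : L (T * T) = ∫ s, L (k s • (U s * T)) := by
    rw [← hTT, L.integral_comp_comm hint]
  have h3 : ∀ s, L (k s • (U s * T)) = k s * Complex.exp (-Complex.I * ξ * s) * μ := by
    intro s
    rw [map_smul, hLUT, hξ s, smul_eq_mul, ← mul_assoc]
  simp_rw [h3] at h2
  rw [hLmul _ hTC _ hTC, hLT, integral_mul_const] at h2
  exact (mul_right_cancel₀ hμ0 h2).symm

/-- If every character of the group is approximated by unit vectors, the spectrum of
`∫ k(s) U_s ds` is the closure of the range of the Fourier transform of `k`. -/
theorem spectrum_average_eq (hU : IsContractionGroup U) (hk : Integrable k)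
    (happ : ∀ ξ : ℝ, ∃ f : ℕ → X, (∀ n, ‖f n‖ = 1) ∧ ∀ s : ℝ, Tendsto
      (fun n => ‖U s (f n) - Complex.exp (-Complex.I * ξ * s) • f n‖) atTop (𝓝 0)) :
    spectrum ℂ (hU.average hk) =
      closure (range fun ξ : ℝ => ∫ s, k s * Complex.exp (-Complex.I * ξ * s)) := by
  refine (hU.spectrum_average_subset hk).antisymm ?_
  refine closure_minimal ?_ (spectrum.isClosed _)
  rintro _ ⟨ξ, rfl⟩
  obtain ⟨f, hf1, hf⟩ := happ ξ
  have hexp : ∀ s : ℝ, ‖Complex.exp (-Complex.I * ξ * s)‖ = 1 := by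
    intro s
    rw [Complex.norm_exp]
    simp
  have hke : Integrable fun s => k s * Complex.exp (-Complex.I * ξ * s) :=
    hk.mono (hk.aestronglyMeasurable.mul (by fun_prop))
      (Eventually.of_forall fun s => by rw [norm_mul, hexp, mul_one])
  set μ := ∫ s, k s * Complex.exp (-Complex.I * ξ * s) with hμ
  intro hunit
  have hdiff : ∀ n, hU.average hk (f n) - μ • f n
      = ∫ s, k s • (U s (f n) - Complex.exp (-Complex.I * ξ * s) • f n) := by
    intro n
    simp_rw [smul_sub, smul_smul]
    rw [integral_sub (hU.integrable_smul hk _) (hke.smul_const _), integral_smul_const,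
      average_apply]
  have hlim : Tendsto (fun n => hU.average hk (f n) - μ • f n) atTop (𝓝 0) := by
    simp_rw [hdiff]
    have h0 : (0 : X) = ∫ _ : ℝ, (0 : X) := by simp
    rw [h0]
    refine tendsto_integral_of_dominated_convergence (fun s => ‖k s‖ * 2) (fun n => ?_)
      (hk.norm.mul_const 2) (fun n => Eventually.of_forall fun s => ?_)
      (Eventually.of_forall fun s => ?_)
    · refine hk.aestronglyMeasurable.smul
        ((hU.stronglyMeasurable _).aestronglyMeasurable.sub ?_)
      exact Continuous.aestronglyMeasurable (by fun_prop)
    · rw [norm_smul]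
      gcongr
      refine (norm_sub_le _ _).trans ?_
      have h1 := hU.norm_apply_le s (f n)
      rw [norm_smul, hexp, hf1]
      rw [hf1] at h1
      linarith
    · have := (tendsto_zero_iff_norm_tendsto_zero.2 (hf s)).const_smul (k s)
      rwa [smul_zero] at this
  -- A bounded left inverse V of μ - T would give f_n = V(μ f_n - T f_n) → 0, against ‖f_n‖ = 1.
  obtain ⟨V, hV⟩ := hunit.exists_left_inv
  have hlim2 : Tendsto (fun n => V (hU.average hk (f n) - μ • f n)) atTop (𝓝 0) := by
    have := (V.continuous.tendsto 0).comp hlim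
    rwa [ContinuousLinearMap.map_zero] at this
  have h5 : ∀ n, V (hU.average hk (f n) - μ • f n) = -f n := by
    intro n
    have h6 := DFunLike.congr_fun hV (f n)
    change V (algebraMap ℂ (X →L[ℂ] X) μ (f n) - hU.average hk (f n)) = f n at h6
    rw [ContinuousLinearMap.algebraMap_apply] at h6
    rw [← neg_sub, map_neg, h6]
  simp_rw [h5] at hlim2
  have h7 := hlim2.norm
  simp only [norm_neg, hf1, norm_zero] at h7
  exact one_ne_zero (tendsto_nhds_unique (tendsto_const_nhds (x := (1 : ℝ))) h7)

end IsContractionGroup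

/-! ### The weighted measure under dilations -/

instance isSigmaFiniteAreaMeasure (a : ℝ) : SigmaFinite (areaMeasure a) :=
  SigmaFinite.withDensity_of_ne_top (Eventually.of_forall fun _ => ENNReal.ofReal_ne_top)

theorem measurable_density (a : ℝ) : Measurable fun z : ℂ => ENNReal.ofReal (z.im ^ (a - 1)) := by
  fun_prop

theorem lintegral_areaMeasure (a : ℝ) {f : ℂ → ENNReal} (hf : Measurable f) :
    ∫⁻ z, f z ∂(areaMeasure a) =
      ∫⁻ z in upperHalfPlane, ENNReal.ofReal (z.im ^ (a - 1)) * f z :=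
  lintegral_withDensity_eq_lintegral_mul _ (measurable_density a) hf

theorem mul_mem_upperHalfPlane_iff {c : ℝ} (hc : 0 < c) (z : ℂ) :
    (c : ℂ) * z ∈ upperHalfPlane ↔ z ∈ upperHalfPlane := by
  simp [upperHalfPlane, hc]

/-- The exponent -(a+1) is the sum of -2 from the planar Jacobian and -(a-1) from the density
y^{a-1}. -/
theorem map_mul_areaMeasure (a : ℝ) {c : ℝ} (hc : 0 < c) :
    Measure.map (fun z : ℂ => (c : ℂ) * z) (areaMeasure a)
      = ENNReal.ofReal (c ^ (-(a + 1))) • areaMeasure a := by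
  have hm : Measurable fun z : ℂ => (c : ℂ) * z := by fun_prop
  refine Measure.ext_of_lintegral _ fun f hf => ?_
  rw [lintegral_map hf hm, lintegral_smul_measure, smul_eq_mul,
    lintegral_areaMeasure a (f := fun z => f ((c : ℂ) * z)) (hf.comp hm), lintegral_areaMeasure a hf,
    ← lintegral_indicator isOpen_upperHalfPlane.measurableSet,
    ← lintegral_indicator isOpen_upperHalfPlane.measurableSet,
    ← lintegral_const_mul' _ _ ENNReal.ofReal_ne_top]
  set G : ℂ → ENNReal := upperHalfPlane.indicator
    fun z => ENNReal.ofReal (z.im ^ (a - 1)) * f z with hG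
  have hGm : Measurable G :=
    ((measurable_density a).mul hf).indicator isOpen_upperHalfPlane.measurableSet
  have h1 : ∫⁻ z : ℂ, G ((c : ℂ) * z) = ENNReal.ofReal (c ^ (-2 : ℝ)) * ∫⁻ z, G z := by
    have h2 := Measure.map_addHaar_smul (volume : Measure ℂ) hc.ne'
    have h3 : (fun z : ℂ => (c : ℂ) * z) = fun z => c • z := by
      funext z; exact (Complex.real_smul).symm
    rw [← lintegral_map hGm hm, h3, h2, lintegral_smul_measure, smul_eq_mul,
      Complex.finrank_real_complex]
    congr 2
    rw [abs_of_pos (by positivity), Real.rpow_neg hc.le]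
    norm_cast
  have h4 : ∀ z : ℂ, upperHalfPlane.indicator
      (fun z => ENNReal.ofReal (z.im ^ (a - 1)) * f ((c : ℂ) * z)) z
      = ENNReal.ofReal (c ^ (-(a - 1))) * G ((c : ℂ) * z) := by
    intro z
    by_cases hz : z ∈ upperHalfPlane
    · rw [indicator_of_mem hz, hG, indicator_of_mem ((mul_mem_upperHalfPlane_iff hc z).2 hz),
        ← mul_assoc, ← ENNReal.ofReal_mul (by positivity), Complex.im_ofReal_mul,
        Real.mul_rpow hc.le (le_of_lt hz), ← mul_assoc, ← Real.rpow_add hc, neg_add_cancel,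
        Real.rpow_zero, one_mul]
    · rw [indicator_of_notMem hz, hG,
        indicator_of_notMem (mt (mul_mem_upperHalfPlane_iff hc z).1 hz), mul_zero]
  simp_rw [h4]
  rw [lintegral_const_mul' _ _ ENNReal.ofReal_ne_top, h1, ← mul_assoc,
    ← ENNReal.ofReal_mul (by positivity), ← Real.rpow_add hc,
    lintegral_const_mul' _ _ ENNReal.ofReal_ne_top]
  congr 3
  ring

/-- The normalized dilation `f ↦ e^{-s(a+1)/p} f(e^{-s} ·)`. -/
def dilate (a p s : ℝ) (f : ℂ → ℂ) (z : ℂ) : ℂ :=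
  (Real.exp (-s * ((a + 1) / p)) : ℂ) * f ((Real.exp (-s) : ℂ) * z)

theorem dilate_zero (a p : ℝ) (f : ℂ → ℂ) : dilate a p 0 f = f := by
  funext z; simp [dilate]

theorem dilate_add (a p s t : ℝ) (f : ℂ → ℂ) :
    dilate a p (s + t) f = dilate a p s (dilate a p t f) := by
  funext z
  simp only [dilate]
  rw [← mul_assoc, ← mul_assoc, ← Complex.ofReal_mul, ← Complex.ofReal_mul, ← Real.exp_add,
    ← Real.exp_add]
  ring_nf

theorem quasiMeasurePreserving_mul (a : ℝ) {c : ℝ} (hc : 0 < c) :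
    Measure.QuasiMeasurePreserving (fun z : ℂ => (c : ℂ) * z) (areaMeasure a) (areaMeasure a) :=
  ⟨by fun_prop, by
    rw [map_mul_areaMeasure a hc]
    exact Measure.smul_absolutelyContinuous⟩

theorem dilate_congr_ae {a : ℝ} (p s : ℝ) {f g : ℂ → ℂ} (h : f =ᵐ[areaMeasure a] g) :
    dilate a p s f =ᵐ[areaMeasure a] dilate a p s g := by
  filter_upwards [(quasiMeasurePreserving_mul a (Real.exp_pos (-s))).ae_eq_comp h] with z hz
  simp only [dilate]
  rw [show f ((Real.exp (-s) : ℂ) * z) = g ((Real.exp (-s) : ℂ) * z) from hz]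

theorem aestronglyMeasurable_dilate {a : ℝ} (p s : ℝ) {f : ℂ → ℂ}
    (hf : AEStronglyMeasurable f (areaMeasure a)) :
    AEStronglyMeasurable (dilate a p s f) (areaMeasure a) :=
  (hf.comp_quasiMeasurePreserving
    (quasiMeasurePreserving_mul a (Real.exp_pos (-s)))).const_mul _

/-- The p-th root of the scaling factor e^{s(a+1)} of the measure is cancelled by the prefactor
e^{-s(a+1)/p} of the dilation. -/
theorem eLpNorm_dilate {a p : ℝ} (hp : 1 ≤ p) (s : ℝ) {f : ℂ → ℂ}
    (hf : AEStronglyMeasurable f (areaMeasure a)) :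
    eLpNorm (dilate a p s f) (ENNReal.ofReal p) (areaMeasure a)
      = eLpNorm f (ENNReal.ofReal p) (areaMeasure a) := by
  have hp0 : 0 < p := by linarith
  have hc := Real.exp_pos (-s)
  have h1 : dilate a p s f = (Real.exp (-s * ((a + 1) / p)) : ℂ) •
      (f ∘ fun z => (Real.exp (-s) : ℂ) * z) := rfl
  have hmap := map_mul_areaMeasure a hc
  have hf' : AEStronglyMeasurable f
      (Measure.map (fun z : ℂ => (Real.exp (-s) : ℂ) * z) (areaMeasure a)) := by
    rw [hmap]
    exact hf.mono_ac Measure.smul_absolutelyContinuous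
  rw [h1, eLpNorm_const_smul, ← eLpNorm_map_measure hf' (by fun_prop), hmap,
    eLpNorm_smul_measure_of_ne_top ENNReal.ofReal_ne_top, smul_eq_mul, ← mul_assoc]
  convert one_mul _
  rw [one_div, ENNReal.toReal_inv, ENNReal.toReal_ofReal hp0.le,
    ENNReal.ofReal_rpow_of_pos (by positivity), ← ofReal_norm, ← ENNReal.ofReal_mul (norm_nonneg _),
    Complex.norm_real, Real.norm_eq_abs, abs_of_pos (Real.exp_pos _), ← Real.exp_mul,
    ← Real.exp_mul, ← Real.exp_add, ENNReal.ofReal_eq_one, Real.exp_eq_one_iff]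
  field_simp
  ring

theorem memLp_dilate {a p : ℝ} (hp : 1 ≤ p) (s : ℝ) {f : ℂ → ℂ}
    (hf : MemLp f (ENNReal.ofReal p) (areaMeasure a)) :
    MemLp (dilate a p s f) (ENNReal.ofReal p) (areaMeasure a) :=
  ⟨aestronglyMeasurable_dilate p s hf.1, by rw [eLpNorm_dilate hp s hf.1]; exact hf.2⟩

/-! ### The dilation group on L^p_a -/

section Lebesgue

variable {a p : ℝ} [hp : Fact (1 ≤ p)]

/-- The dilation group on `L^p_a`. -/
def lebesgueDilation (a p : ℝ) [hp : Fact (1 ≤ p)] (s : ℝ) :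
    LebesgueSpace a p →L[ℂ] LebesgueSpace a p :=
  LinearMap.mkContinuous
    { toFun := fun f => (memLp_dilate hp.out s (Lp.memLp f)).toLp _
      map_add' := fun f g => by
        rw [← MemLp.toLp_add, MemLp.toLp_eq_toLp_iff]
        refine (dilate_congr_ae p s (Lp.coeFn_add f g)).trans (Eventually.of_forall fun z => ?_)
        simp [dilate, mul_add]
      map_smul' := fun c f => by
        rw [RingHom.id_apply, ← MemLp.toLp_const_smul, MemLp.toLp_eq_toLp_iff]
        refine (dilate_congr_ae p s (Lp.coeFn_smul c f)).trans (Eventually.of_forall fun z => ?_)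
        simp [dilate, mul_left_comm] }
    1 fun f => by
      refine le_of_eq ?_
      rw [one_mul]
      change ‖MemLp.toLp _ (memLp_dilate hp.out s (Lp.memLp f))‖ = _
      rw [Lp.norm_toLp, eLpNorm_dilate hp.out s (Lp.aestronglyMeasurable f), Lp.norm_def]

theorem coeFn_lebesgueDilation (s : ℝ) (f : LebesgueSpace a p) :
    lebesgueDilation a p s f =ᵐ[areaMeasure a] dilate a p s f :=
  MemLp.coeFn_toLp (memLp_dilate hp.out s (Lp.memLp f))

/-- A map into a separable metric space is measurable when all distances are. -/
theorem measurable_of_measurable_dist {α E : Type*} [MeasurableSpace α] [PseudoMetricSpace E]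
    [SecondCountableTopology E] [MeasurableSpace E] [BorelSpace E] {F : α → E}
    (h : ∀ y, Measurable fun x => dist (F x) y) : Measurable F := by
  refine measurable_of_isOpen fun V hV => ?_
  have h1 : ∀ y : V, ∃ r > 0, Metric.ball (y : E) r ⊆ V := fun y =>
    Metric.isOpen_iff.1 hV y y.2
  choose r hr hrV using h1
  obtain ⟨T, hT, hTV⟩ := TopologicalSpace.isOpen_iUnion_countable
    (fun y : V => Metric.ball (y : E) (r y)) fun y => Metric.isOpen_ball
  have h2 : V = ⋃ y ∈ T, Metric.ball (y : E) (r y) := by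
    rw [hTV]
    refine Subset.antisymm (fun y hy => mem_iUnion.2 ⟨⟨y, hy⟩, Metric.mem_ball_self (hr _)⟩) ?_
    exact iUnion_subset hrV
  rw [h2, preimage_iUnion₂]
  exact MeasurableSet.biUnion hT fun y _ => (h y) measurableSet_Iio

theorem measurable_uncurry_dilate (a p : ℝ) {f : ℂ → ℂ} (hf : Measurable f) :
    Measurable fun q : ℝ × ℂ => dilate a p q.1 f q.2 := by
  unfold dilate
  refine Measurable.mul (by fun_prop) (hf.comp (by fun_prop))

/-- Since L^p_a with p < ∞ is separable, it is enough that s ↦ ‖U_s f - h‖ is measurable for each h.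
This holds by Tonelli, the integrand being jointly measurable. No strong continuity of the group is
needed. -/
theorem stronglyMeasurable_lebesgueDilation (f : LebesgueSpace a p) :
    StronglyMeasurable fun s => lebesgueDilation a p s f := by
  have hp1 : 1 ≤ p := hp.out
  have hp0 : 0 < p := by linarith
  have : Fact (ENNReal.ofReal p ≠ ⊤) := ⟨ENNReal.ofReal_ne_top⟩
  borelize (LebesgueSpace a p)
  refine Measurable.stronglyMeasurable (measurable_of_measurable_dist fun h => ?_)
  have h1 : ∀ s, dist (lebesgueDilation a p s f) h = ((∫⁻ z, ‖dilate a p s f z - h z‖ₑ ^ p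
      ∂(areaMeasure a)) ^ (1 / p)).toReal := by
    intro s
    rw [Lp.dist_def, eLpNorm_eq_lintegral_rpow_enorm_toReal (by simpa using hp0)
      ENNReal.ofReal_ne_top, ENNReal.toReal_ofReal hp0.le]
    congr 2
    refine lintegral_congr_ae ?_
    filter_upwards [coeFn_lebesgueDilation s f] with z hz
    rw [Pi.sub_apply, hz]
  simp_rw [h1]
  refine (Measurable.pow_const ?_ _).ennreal_toReal
  refine Measurable.lintegral_prod_right'
    (f := fun q : ℝ × ℂ => ‖dilate a p q.1 f q.2 - h q.2‖ₑ ^ p) ?_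
  exact (((measurable_uncurry_dilate a p (Lp.stronglyMeasurable f).measurable).sub
    ((Lp.stronglyMeasurable h).measurable.comp measurable_snd)).enorm).pow_const _

theorem isContractionGroup_lebesgueDilation : IsContractionGroup (lebesgueDilation a p) where
  map_zero := by
    refine ContinuousLinearMap.ext fun f => Lp.ext ?_
    refine (coeFn_lebesgueDilation 0 f).trans ?_
    rw [dilate_zero]
    rfl
  map_add s t := by
    refine ContinuousLinearMap.ext fun f => Lp.ext ?_
    refine (coeFn_lebesgueDilation (s + t) f).trans ?_
    rw [dilate_add]
    exact ((coeFn_lebesgueDilation s (lebesgueDilation a p t f)).trans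
      (dilate_congr_ae p s (coeFn_lebesgueDilation t f))).symm
  norm_apply_le s f := by
    change ‖MemLp.toLp _ (memLp_dilate hp.out s (Lp.memLp f))‖ ≤ _
    rw [Lp.norm_toLp, eLpNorm_dilate hp.out s (Lp.aestronglyMeasurable f), Lp.norm_def]
  stronglyMeasurable := stronglyMeasurable_lebesgueDilation

end Lebesgue

/-! ### Mean value estimates and local comparison of measures -/

theorem enorm_le_lintegral_circle {f : ℂ → ℂ} {z : ℂ} {r : ℝ} (hr : 0 < r)
    (hf : DifferentiableOn ℂ f (Metric.closedBall z r)) :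
    ENNReal.ofReal (2 * Real.pi) * ‖f z‖ₑ ≤
      ∫⁻ θ in Ioo (-Real.pi) Real.pi, ‖f (circleMap z r θ)‖ₑ := by
  have hd : DiffContOnCl ℂ f (Metric.ball z |r|) := by
    refine DifferentiableOn.diffContOnCl ?_
    rwa [closure_ball _ (by simpa using hr.ne'), abs_of_pos hr]
  have h1 := hd.circleAverage
  rw [Real.circleAverage_eq_integral_add (-Real.pi),
    intervalIntegral.integral_comp_add_right (fun θ => f (circleMap z r θ))] at h1
  have h2 : (2 * Real.pi) • f z = ∫ θ in (-Real.pi)..Real.pi, f (circleMap z r θ) := by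
    rw [← h1, smul_smul, mul_inv_cancel₀ (by positivity), one_smul]
    congr 1 <;> ring
  rw [intervalIntegral.integral_of_le (by linarith [Real.pi_pos]),
    integral_Ioc_eq_integral_Ioo] at h2
  calc ENNReal.ofReal (2 * Real.pi) * ‖f z‖ₑ = ‖(2 * Real.pi) • f z‖ₑ := by
        rw [enorm_smul, Real.enorm_of_nonneg (by positivity)]
    _ ≤ _ := by rw [h2]; exact enorm_integral_le_lintegral_enorm _

/-- In polar coordinates, the mean value inequality is integrated over radii in (R/2, R) only. There
the Jacobian r is at least R/2 and the interval has length R/2, whence the constant (R/2)² · 2π. -/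
theorem enorm_le_lintegral_ball {f : ℂ → ℂ} (hfm : Measurable f) {z : ℂ} {R : ℝ} (hR : 0 < R)
    (hf : DifferentiableOn ℂ f (Metric.ball z R)) :
    ENNReal.ofReal (R / 2 * (R / 2)) * (ENNReal.ofReal (2 * Real.pi) * ‖f z‖ₑ) ≤
      ∫⁻ w in Metric.ball z R, ‖f w‖ₑ := by
  set G : ℂ → ENNReal := (Metric.ball (0 : ℂ) R).indicator fun w => ‖f (z + w)‖ₑ with hG
  have hGm : Measurable G :=
    (hfm.comp (measurable_const_add z)).enorm.indicator measurableSet_ball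
  have h1 : ∫⁻ w in Metric.ball z R, ‖f w‖ₑ = ∫⁻ w, G w := by
    rw [← lintegral_indicator measurableSet_ball, ← lintegral_add_left_eq_self _ z]
    refine lintegral_congr fun w => ?_
    simp only [hG, indicator, Metric.mem_ball, dist_self_add_left, dist_zero_right]
  have h2 : Measurable fun q : ℝ × ℝ =>
      ENNReal.ofReal q.1 • G (Complex.polarCoord.symm q) := by
    refine (ENNReal.measurable_ofReal.comp measurable_fst).smul (hGm.comp ?_)
    have h3 : (Complex.polarCoord.symm : ℝ × ℝ → ℂ) =
        fun q => q.1 * (Real.cos q.2 + Real.sin q.2 * Complex.I) :=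
      funext Complex.polarCoord_symm_apply
    rw [h3]
    fun_prop
  rw [h1, ← Complex.lintegral_comp_polarCoord_symm, polarCoord_target,
    Measure.volume_eq_prod, ← Measure.prod_restrict, lintegral_prod _ h2.aemeasurable]
  have hsub : Ioo (R / 2) R ⊆ Ioi 0 := fun r hr => lt_trans (by positivity) hr.1
  refine le_trans ?_ (lintegral_mono_set hsub)
  calc ENNReal.ofReal (R / 2 * (R / 2)) * (ENNReal.ofReal (2 * Real.pi) * ‖f z‖ₑ)
      = ∫⁻ _ in Ioo (R / 2) R, ENNReal.ofReal (R / 2) *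
          (ENNReal.ofReal (2 * Real.pi) * ‖f z‖ₑ) := by
        rw [setLIntegral_const, Real.volume_Ioo, ENNReal.ofReal_mul (by positivity)]
        rw [show R - R / 2 = R / 2 by ring]
        ring
    _ ≤ _ := by
        refine setLIntegral_mono' measurableSet_Ioo fun r hr => ?_
        have hr0 : 0 < r := hsub hr
        have h3 : ∀ θ : ℝ, G (Complex.polarCoord.symm (r, θ)) = ‖f (circleMap z r θ)‖ₑ := by
          intro θ
          have h4 : Complex.polarCoord.symm (r, θ) = r * Complex.exp (θ * Complex.I) := by
            rw [Complex.polarCoord_symm_apply, Complex.exp_mul_I]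
            push_cast
            rfl
          have h5 : ‖(r : ℂ) * Complex.exp (θ * Complex.I)‖ = r := by
            rw [norm_mul, Complex.norm_exp_ofReal_mul_I, mul_one, Complex.norm_real,
              Real.norm_eq_abs, abs_of_pos hr0]
          rw [h4, hG, indicator_of_mem (by rw [mem_ball_zero_iff, h5]; exact hr.2)]
          rfl
        simp only [h3, smul_eq_mul]
        rw [lintegral_const_mul' _ _ ENNReal.ofReal_ne_top]
        refine mul_le_mul' (ENNReal.ofReal_le_ofReal hr.1.le)
          (enorm_le_lintegral_circle hr0 (hf.mono (Metric.closedBall_subset_ball hr.2)))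

/-- The density y^{a-1} is continuous and positive on K, hence bounded below by some m > 0. -/
theorem exists_restrict_le_smul_areaMeasure (a : ℝ) {K : Set ℂ} (hK : IsCompact K)
    (hKU : K ⊆ upperHalfPlane) :
    ∃ c : ENNReal, c ≠ ⊤ ∧ volume.restrict K ≤ c • areaMeasure a := by
  obtain ⟨m, hm, hmK⟩ : ∃ m : ℝ, 0 < m ∧ ∀ z ∈ K, m ≤ z.im ^ (a - 1) := by
    rcases K.eq_empty_or_nonempty with rfl | hne
    · exact ⟨1, one_pos, by simp⟩
    have hc : ContinuousOn (fun z : ℂ => z.im ^ (a - 1)) K :=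
      Complex.continuous_im.continuousOn.rpow_const fun z hz => Or.inl (ne_of_gt (hKU hz))
    obtain ⟨w, hw, hmin⟩ := hK.exists_isMinOn hne hc
    exact ⟨_, Real.rpow_pos_of_pos (hKU hw) _, fun z hz => hmin hz⟩
  refine ⟨(ENNReal.ofReal m)⁻¹, ENNReal.inv_ne_top.2 (by simpa using hm),
    Measure.le_iff.2 fun s hs => ?_⟩
  rw [Measure.restrict_apply hs, Measure.smul_apply, smul_eq_mul, mul_comm, ← div_eq_mul_inv,
    ENNReal.le_div_iff_mul_le (Or.inl (by simpa using hm)) (Or.inl ENNReal.ofReal_ne_top),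
    areaMeasure, withDensity_apply _ hs, Measure.restrict_restrict hs]
  calc volume (s ∩ K) * ENNReal.ofReal m = ∫⁻ _ in s ∩ K, ENNReal.ofReal m := by
        rw [setLIntegral_const, mul_comm]
    _ ≤ ∫⁻ z in s ∩ K, ENNReal.ofReal (z.im ^ (a - 1)) :=
        setLIntegral_mono' (hs.inter hK.measurableSet) fun z hz =>
          ENNReal.ofReal_le_ofReal (hmK z hz.2)
    _ ≤ _ := lintegral_mono_set (inter_subset_inter_right _ hKU)

theorem exists_lintegral_le_eLpNorm {a p : ℝ} (hp : 1 ≤ p) {K : Set ℂ} (hK : IsCompact K)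
    (hKU : K ⊆ upperHalfPlane) :
    ∃ c : ENNReal, c ≠ ⊤ ∧ ∀ f : ℂ → ℂ, Measurable f →
      ∫⁻ z in K, ‖f z‖ₑ ≤ c * eLpNorm f (ENNReal.ofReal p) (areaMeasure a) := by
  obtain ⟨c, hc, hle⟩ := exists_restrict_le_smul_areaMeasure a hK hKU
  set e : ℝ := 1 / (1 : ENNReal).toReal - 1 / (ENNReal.ofReal p).toReal with he
  have he0 : 0 ≤ e := by
    rw [he, ENNReal.toReal_ofReal (by linarith), ENNReal.toReal_one]
    have : 1 / p ≤ 1 := (div_le_one (by linarith)).2 hp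
    linarith
  refine ⟨c ^ (1 / ENNReal.ofReal p).toReal * volume K ^ e, ?_, fun f hf => ?_⟩
  · exact ENNReal.mul_ne_top (ENNReal.rpow_ne_top_of_nonneg ENNReal.toReal_nonneg hc)
      (ENNReal.rpow_ne_top_of_nonneg he0 hK.measure_lt_top.ne)
  · have h1 := eLpNorm_le_eLpNorm_mul_rpow_measure_univ (μ := volume.restrict K) (f := f)
      (p := 1) (q := ENNReal.ofReal p) (by simpa using ENNReal.ofReal_le_ofReal hp)
      hf.aestronglyMeasurable
    rw [eLpNorm_one_eq_lintegral_enorm, Measure.restrict_apply_univ] at h1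
    have h2 := eLpNorm_mono_measure f (p := ENNReal.ofReal p) hle
    rw [eLpNorm_smul_measure_of_ne_top ENNReal.ofReal_ne_top, smul_eq_mul] at h2
    refine h1.trans ?_
    rw [mul_right_comm]
    gcongr

/-! ### The Bergman space: evaluations, completeness, dilations -/

section Bergman

namespace BergmanSpace

variable {a p : ℝ}

theorem differentiableOn (f : BergmanSpace a p) : DifferentiableOn ℂ f upperHalfPlane := f.2.1

theorem eq_zero_of_notMem (f : BergmanSpace a p) {z : ℂ} (hz : z ∉ upperHalfPlane) : f z = 0 :=
  f.2.2.1 z hz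

theorem measurable (f : BergmanSpace a p) : Measurable f := by
  classical
  have h1 : (f : ℂ → ℂ) = upperHalfPlane.piecewise f (fun _ => 0) := by
    funext z
    by_cases hz : z ∈ upperHalfPlane
    · rw [piecewise_eq_of_mem _ _ _ hz]
    · rw [piecewise_eq_of_notMem _ _ _ hz, f.eq_zero_of_notMem hz]
  rw [h1]
  exact f.differentiableOn.continuousOn.measurable_piecewise continuousOn_const
    isOpen_upperHalfPlane.measurableSet

theorem sub_apply (f g : BergmanSpace a p) (z : ℂ) : (f - g) z = f z - g z := rfl

variable [hp : Fact (1 ≤ p)]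

/-- Point evaluations are bounded, locally uniformly. -/
theorem exists_norm_apply_le (a p : ℝ) [hp : Fact (1 ≤ p)] {z₀ : ℂ} (hz₀ : z₀ ∈ upperHalfPlane) :
    ∃ r > 0, Metric.ball z₀ r ⊆ upperHalfPlane ∧ ∃ C : ℝ, 0 ≤ C ∧ ∀ f : BergmanSpace a p,
      ∀ z ∈ Metric.ball z₀ r, ‖f z‖ ≤ C * ‖f‖ := by
  obtain ⟨ε, hε, hεU⟩ := Metric.isOpen_iff.1 isOpen_upperHalfPlane z₀ hz₀
  -- With this radius, every ball of radius R about a point of the R-ball at z₀ stays in one compact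
  -- ball of radius 2R inside the half-plane, so the constant is uniform.
  set R := ε / 4 with hR
  have hR0 : 0 < R := by positivity
  have hKU : Metric.closedBall z₀ (2 * R) ⊆ upperHalfPlane :=
    (Metric.closedBall_subset_ball (by linarith)).trans hεU
  obtain ⟨c, hc, hcK⟩ :=
    exists_lintegral_le_eLpNorm (a := a) hp.out (isCompact_closedBall z₀ (2 * R)) hKU
  set b : ℝ := R / 2 * (R / 2) * (2 * Real.pi) with hb
  have hb0 : 0 < b := by positivity
  refine ⟨R, hR0, (Metric.ball_subset_ball (by linarith)).trans hεU, c.toReal / b,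
    by positivity, fun f z hz => ?_⟩
  have hzK : Metric.ball z R ⊆ Metric.closedBall z₀ (2 * R) := by
    intro w hw
    have h1 := dist_triangle w z z₀
    rw [Metric.mem_ball] at hw hz
    rw [Metric.mem_closedBall]
    linarith
  have h2 := enorm_le_lintegral_ball f.measurable hR0 (f.differentiableOn.mono (hzK.trans hKU))
  have h3 := (h2.trans (lintegral_mono_set hzK)).trans (hcK f f.measurable)
  rw [← mul_assoc, ← ENNReal.ofReal_mul (by positivity)] at h3
  have h4 := ENNReal.toReal_mono (ENNReal.mul_ne_top hc f.memLp.eLpNorm_ne_top) h3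
  rw [ENNReal.toReal_mul, ENNReal.toReal_mul, ENNReal.toReal_ofReal hb0.le, toReal_enorm,
    ← norm_eq] at h4
  rw [div_mul_eq_mul_div, le_div_iff₀ hb0]
  linarith

/-- The isometric inclusion of `A^p_a` in `L^p_a`. -/
def toLebesgue (a p : ℝ) [hp : Fact (1 ≤ p)] : BergmanSpace a p →ₗᵢ[ℂ] LebesgueSpace a p where
  toFun f := f.memLp.toLp _
  map_add' f g := rfl
  map_smul' c f := rfl
  norm_map' f := by
    change ‖f.memLp.toLp _‖ = _
    rw [Lp.norm_toLp, norm_eq]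

theorem coeFn_toLebesgue (f : BergmanSpace a p) : toLebesgue a p f =ᵐ[areaMeasure a] f :=
  f.memLp.coeFn_toLp

/-- Evaluation at a point of the half-plane. -/
def eval {z : ℂ} (hz : z ∈ upperHalfPlane) : BergmanSpace a p →L[ℂ] ℂ :=
  LinearMap.mkContinuousOfExistsBound
    { toFun := fun f => f z, map_add' := fun _ _ => rfl, map_smul' := fun _ _ => rfl } (by
      obtain ⟨r, hr, -, C, -, hC⟩ := exists_norm_apply_le a p hz
      exact ⟨C, fun f => hC f z (Metric.mem_ball_self hr)⟩)

theorem eval_apply {z : ℂ} (hz : z ∈ upperHalfPlane) (f : BergmanSpace a p) :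
    eval hz f = f z := rfl

/-- Locally uniform bounds on evaluations make a Cauchy sequence converge locally uniformly to a
holomorphic F. It also converges in L^p_a, and an a.e. convergent subsequence identifies that limit
with F. -/
instance completeSpace : CompleteSpace (BergmanSpace a p) := by
  refine Metric.complete_of_cauchySeq_tendsto fun u hu => ?_
  have hlim : ∀ z : ℂ, ∃ w : ℂ, Tendsto (fun n => u n z) atTop (𝓝 w) ∧
      (z ∉ upperHalfPlane → w = 0) := by
    intro z
    by_cases hz : z ∈ upperHalfPlane
    · obtain ⟨w, hw⟩ := cauchySeq_tendsto_of_complete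
        ((eval (a := a) (p := p) hz).uniformContinuous.comp_cauchySeq hu)
      exact ⟨w, hw, fun h => absurd hz h⟩
    · refine ⟨0, ?_, fun _ => rfl⟩
      simp_rw [fun n => (u n).eq_zero_of_notMem hz]
      exact tendsto_const_nhds
  choose F hF hF0 using hlim
  obtain ⟨g, hg⟩ := cauchySeq_tendsto_of_complete
    ((toLebesgue a p).isometry.uniformContinuous.comp_cauchySeq hu)
  have hunif : TendstoLocallyUniformlyOn (fun n z => u n z) F atTop upperHalfPlane := by
    refine Metric.tendstoLocallyUniformlyOn_iff.2 fun ε hε z₀ hz₀ => ?_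
    obtain ⟨r, hr, hrU, C, hC0, hC⟩ := exists_norm_apply_le a p hz₀
    refine ⟨Metric.ball z₀ r, mem_nhdsWithin_of_mem_nhds (Metric.ball_mem_nhds _ hr), ?_⟩
    obtain ⟨N, hN⟩ := Metric.cauchySeq_iff.1 hu (ε / (2 * (C + 1))) (by positivity)
    filter_upwards [eventually_ge_atTop N] with n hn z hz
    have h1 : dist (F z) (u n z) ≤ ε / 2 := by
      refine le_of_tendsto ((hF z).dist tendsto_const_nhds) ?_
      filter_upwards [eventually_ge_atTop N] with m hm
      have h2 := hC (u m - u n) z hz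
      rw [sub_apply, ← dist_eq_norm, ← dist_eq_norm] at h2
      refine h2.trans ((mul_le_mul_of_nonneg_left (hN m hm n hn).le hC0).trans ?_)
      rw [mul_div_assoc', div_le_div_iff₀ (by positivity) two_pos]
      nlinarith
    linarith
  have hdiff : DifferentiableOn ℂ F upperHalfPlane :=
    hunif.differentiableOn (Eventually.of_forall fun n => (u n).differentiableOn)
      isOpen_upperHalfPlane
  have hae : (g : ℂ → ℂ) =ᵐ[areaMeasure a] F := by
    obtain ⟨ns, hns, hns'⟩ := (tendstoInMeasure_of_tendsto_Lp hg).exists_seq_tendsto_ae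
    have h1 : ∀ᵐ z ∂(areaMeasure a), ∀ n, toLebesgue a p (u n) z = u n z :=
      ae_all_iff.2 fun n => coeFn_toLebesgue (u n)
    filter_upwards [hns', h1] with z hz hz1
    refine tendsto_nhds_unique hz ?_
    simp only [Function.comp_apply, hz1]
    exact (hF z).comp hns.tendsto_atTop
  let F' : BergmanSpace a p :=
    ⟨F, hdiff, hF0, (memLp_congr_ae hae).1 (Lp.memLp g)⟩
  have hF'g : toLebesgue a p F' = g := Lp.ext ((coeFn_toLebesgue F').trans hae.symm)
  refine ⟨F', ?_⟩
  rw [← hF'g] at hg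
  exact (toLebesgue a p).isometry.isEmbedding.tendsto_nhds_iff.2 hg

theorem dilate_mem (s : ℝ) (f : BergmanSpace a p) :
    dilate a p s f ∈ bergmanSubmodule a p := by
  refine ⟨?_, fun z hz => ?_, memLp_dilate hp.out s f.memLp⟩
  · refine DifferentiableOn.const_mul (f.differentiableOn.comp (by fun_prop) fun z hz => ?_) _
    exact (mul_mem_upperHalfPlane_iff (Real.exp_pos _) z).2 hz
  · rw [dilate, f.eq_zero_of_notMem (mt (mul_mem_upperHalfPlane_iff (Real.exp_pos _) z).1 hz),
      mul_zero]

end BergmanSpace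

variable {a p : ℝ} [hp : Fact (1 ≤ p)]

/-- The dilation group on `A^p_a`. -/
def bergmanDilation (a p : ℝ) [hp : Fact (1 ≤ p)] (s : ℝ) :
    BergmanSpace a p →L[ℂ] BergmanSpace a p :=
  LinearMap.mkContinuous
    { toFun := fun f => (⟨dilate a p s f, f.dilate_mem s⟩ : bergmanSubmodule a p)
      map_add' := fun f g => Subtype.ext (funext fun z => mul_add _ _ _)
      map_smul' := fun c f => Subtype.ext (funext fun z => mul_left_comm _ _ _) }
    1 fun f => by
      refine le_of_eq ?_
      rw [one_mul, BergmanSpace.norm_eq, BergmanSpace.norm_eq]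
      congr 1
      exact eLpNorm_dilate hp.out s f.memLp.1

theorem toLebesgue_bergmanDilation (s : ℝ) (f : BergmanSpace a p) :
    BergmanSpace.toLebesgue a p (bergmanDilation a p s f)
      = lebesgueDilation a p s (BergmanSpace.toLebesgue a p f) :=
  Lp.ext (((bergmanDilation a p s f).coeFn_toLebesgue.trans
    (dilate_congr_ae p s f.coeFn_toLebesgue.symm)).trans (coeFn_lebesgueDilation s _).symm)

theorem isContractionGroup_bergmanDilation : IsContractionGroup (bergmanDilation a p) where
  map_zero := ContinuousLinearMap.ext fun f => Subtype.ext (dilate_zero a p f)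
  map_add s t := ContinuousLinearMap.ext fun f => Subtype.ext (dilate_add a p s t f)
  norm_apply_le s f := by
    rw [← (BergmanSpace.toLebesgue a p).norm_map, toLebesgue_bergmanDilation,
      ← (BergmanSpace.toLebesgue a p).norm_map f]
    exact isContractionGroup_lebesgueDilation.norm_apply_le s _
  stronglyMeasurable f := by
    -- Strong measurability is inherited from L^p_a through the isometric embedding.
    refine (Embedding.comp_stronglyMeasurable_iff
      (BergmanSpace.toLebesgue a p).isometry.isEmbedding).1 ?_
    simp_rw [toLebesgue_bergmanDilation]
    exact stronglyMeasurable_lebesgueDilation _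

end Bergman

/-! ### Approximate eigenfunctions of the dilations -/

/-- The function `|t|⁻¹ min (|t|^δ) (|t|^{-δ})`. -/
def logDecay (δ t : ℝ) : ℝ := Real.exp (-Real.log t - δ * |Real.log t|)

/-- The function is t^{δ-1} on (0, 1] and t^{-δ-1} beyond 1. Since `Real.log` is even, the negative
half-line follows by reflection. -/
theorem integrable_logDecay {δ : ℝ} (hδ : 0 < δ) : Integrable (logDecay δ) := by
  have h1 : IntegrableOn (logDecay δ) (Ioc 0 1) := by
    have h2 : IntegrableOn (fun t : ℝ => t ^ (δ - 1)) (Ioc 0 1) :=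
      (intervalIntegrable_iff_integrableOn_Ioc_of_le zero_le_one).1
        (intervalIntegral.intervalIntegrable_rpow' (by linarith))
    refine h2.congr_fun (fun t ht => ?_) measurableSet_Ioc
    have h3 := Real.log_nonpos ht.1.le ht.2
    simp only [logDecay]
    rw [Real.rpow_def_of_pos ht.1, abs_of_nonpos h3]
    congr 1
    ring
  have h2 : IntegrableOn (logDecay δ) (Ioi 1) := by
    refine (integrableOn_Ioi_rpow_of_lt (a := -δ - 1) (by linarith) one_pos).congr_fun
      (fun t ht => ?_) measurableSet_Ioi
    have ht0 : (0 : ℝ) < t := lt_trans one_pos ht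
    have h3 := Real.log_nonneg (le_of_lt ht)
    simp only [logDecay]
    rw [Real.rpow_def_of_pos ht0, abs_of_nonneg h3]
    congr 1
    ring
  have h3 : IntegrableOn (logDecay δ) (Ioi 0) := by
    rw [← Ioc_union_Ioi_eq_Ioi (zero_le_one (α := ℝ))]
    exact h1.union h2
  have h4 : IntegrableOn (logDecay δ) (Iic 0) := by
    have h5 : IntegrableOn (fun t => logDecay δ (-t)) (Ici 0) := by
      simp only [logDecay, Real.log_neg_eq_log]
      exact (integrableOn_Ici_iff_integrableOn_Ioi).2 h3
    simpa using h5.comp_neg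
  rw [← integrableOn_univ, ← Iic_union_Ioi (a := (0 : ℝ))]
  exact h4.union h3

theorem integrable_logDecay_re_mul_im {δ : ℝ} (hδ : 0 < δ) :
    Integrable fun z : ℂ => logDecay δ z.re * logDecay δ z.im :=
  (Complex.volume_preserving_equiv_real_prod.integrable_comp_emb
    Complex.measurableEquivRealProd.measurableEmbedding).2
    ((integrable_logDecay hδ).mul_prod (integrable_logDecay hδ))

theorem ae_re_ne_zero : ∀ᵐ z : ℂ, z.re ≠ 0 := by
  have h1 : Measure.QuasiMeasurePreserving Complex.re (volume : Measure ℂ) (volume : Measure ℝ) :=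
    Measure.quasiMeasurePreserving_fst.comp
      Complex.volume_preserving_equiv_real_prod.quasiMeasurePreserving
  exact h1.ae (Measure.ae_ne volume 0)

/-- The factor e^{|log c|} is max(c, 1/c), which dominates both c and 1, hence both coordinates of
cz + i. -/
theorem norm_mul_add_I_le {c : ℝ} (hc : 0 < c) {z : ℂ} (hz : z ∈ upperHalfPlane) :
    ‖(c : ℂ) * z + Complex.I‖ ≤ Real.exp |Real.log c| * ‖z + Complex.I‖ := by
  have hz' : 0 < z.im := hz
  set m := Real.exp |Real.log c| with hm
  have hm1 : 1 ≤ m := Real.one_le_exp (abs_nonneg _)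
  have hmc : c ≤ m := by
    rw [hm]
    calc c = Real.exp (Real.log c) := (Real.exp_log hc).symm
      _ ≤ _ := Real.exp_le_exp.2 (le_abs_self _)
  refine le_of_sq_le_sq ?_ (by positivity)
  rw [mul_pow, ← Complex.normSq_eq_norm_sq, ← Complex.normSq_eq_norm_sq, Complex.normSq_apply,
    Complex.normSq_apply]
  simp only [Complex.add_re, Complex.mul_re, Complex.ofReal_re, Complex.ofReal_im, zero_mul,
    sub_zero, Complex.I_re, add_zero, Complex.add_im, Complex.mul_im, Complex.I_im]
  have h1 : c * z.im + 1 ≤ m * (z.im + 1) := by nlinarith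
  have h2 : (c * z.im + 1) * (c * z.im + 1) ≤ (m * (z.im + 1)) * (m * (z.im + 1)) :=
    mul_self_le_mul_self (by positivity) h1
  have h3 : c * c ≤ m * m := mul_self_le_mul_self hc.le hmc
  nlinarith [mul_le_mul_of_nonneg_right h3 (mul_self_nonneg z.re)]

/-- `z^{-(a+1)/p + iξ} (z / (z + i)²)^ε` on the half-plane. -/
def approxEigenfunction (a p ξ ε : ℝ) : ℂ → ℂ :=
  upperHalfPlane.indicator fun z => Complex.exp
    (((-((a + 1) / p) + ε : ℝ) + Complex.I * ξ) * Complex.log z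
      - 2 * ε * Complex.log (z + Complex.I))

theorem add_I_mem_upperHalfPlane {z : ℂ} (hz : z ∈ upperHalfPlane) :
    z + Complex.I ∈ upperHalfPlane := by
  have hz' : 0 < z.im := hz
  change 0 < (z + Complex.I).im
  rw [Complex.add_im, Complex.I_im]
  linarith

theorem ne_zero_of_mem_upperHalfPlane {z : ℂ} (hz : z ∈ upperHalfPlane) : z ≠ 0 := by
  rintro rfl
  exact lt_irrefl (0 : ℝ) hz

theorem mem_slitPlane_of_mem_upperHalfPlane {z : ℂ} (hz : z ∈ upperHalfPlane) :
    z ∈ Complex.slitPlane := Or.inr (ne_of_gt hz)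

theorem differentiableOn_approxEigenfunction (a p ξ ε : ℝ) :
    DifferentiableOn ℂ (approxEigenfunction a p ξ ε) upperHalfPlane := by
  refine DifferentiableOn.congr (f := fun z => Complex.exp
    (((-((a + 1) / p) + ε : ℝ) + Complex.I * ξ) * Complex.log z
      - 2 * ε * Complex.log (z + Complex.I))) (fun z hz => ?_)
    fun z hz => indicator_of_mem hz _
  have h1 := mem_slitPlane_of_mem_upperHalfPlane hz
  have h2 := mem_slitPlane_of_mem_upperHalfPlane (add_I_mem_upperHalfPlane hz)
  refine DifferentiableAt.differentiableWithinAt ?_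
  exact (((differentiableAt_id.clog h1).const_mul _).sub
    (((differentiableAt_id.add_const _).clog h2).const_mul _)).cexp

/-- On the half-plane |z + i| ≥ max(1, |z|), so |z|/|z+i|² ≤ min(|z|, 1/|z|): the regularizing
factor decays both at 0 and at infinity. -/
theorem log_norm_bounds {z : ℂ} (hz : z ∈ upperHalfPlane) :
    Real.log ‖z‖ - 2 * Real.log ‖z + Complex.I‖ ≤ -|Real.log ‖z‖| := by
  have hz' : 0 < z.im := hz
  have h0 : 0 < ‖z‖ := norm_pos_iff.2 (ne_zero_of_mem_upperHalfPlane hz)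
  have h1 : (1 : ℝ) ≤ ‖z + Complex.I‖ := by
    refine le_trans ?_ (Complex.abs_im_le_norm _)
    simp only [Complex.add_im, Complex.I_im]
    exact le_trans (by linarith) (le_abs_self _)
  have h2 : ‖z‖ ≤ ‖z + Complex.I‖ := by
    refine le_of_sq_le_sq ?_ (norm_nonneg _)
    rw [← Complex.normSq_eq_norm_sq, ← Complex.normSq_eq_norm_sq, Complex.normSq_apply,
      Complex.normSq_apply]
    simp only [Complex.add_re, Complex.add_im, Complex.I_re, Complex.I_im]
    nlinarith
  have h3 := Real.log_nonneg h1
  have h4 := Real.log_le_log h0 h2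
  rcases abs_cases (Real.log ‖z‖) with ⟨h, _⟩ | ⟨h, _⟩ <;> rw [h] <;> linarith

theorem norm_approxEigenfunction_le (a p ξ : ℝ) {ε : ℝ} (hε : 0 < ε) {z : ℂ}
    (hz : z ∈ upperHalfPlane) :
    ‖approxEigenfunction a p ξ ε z‖ ≤ Real.exp (|ξ| * Real.pi) *
      Real.exp (-((a + 1) / p) * Real.log ‖z‖ - ε * |Real.log ‖z‖|) := by
  rw [approxEigenfunction, indicator_of_mem hz, Complex.norm_exp, ← Real.exp_add,
    Real.exp_le_exp]
  have h1 : ((((-((a + 1) / p) + ε : ℝ) + Complex.I * ξ) * Complex.log z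
      - 2 * ε * Complex.log (z + Complex.I)) : ℂ).re
      = (-((a + 1) / p) + ε) * Real.log ‖z‖ - ξ * z.arg - 2 * ε * Real.log ‖z + Complex.I‖ := by
    simp [Complex.log_re, Complex.log_im]
  rw [h1]
  have h2 : -(ξ * z.arg) ≤ |ξ| * Real.pi := by
    refine (neg_le_abs _).trans ?_
    rw [abs_mul]
    exact mul_le_mul_of_nonneg_left (Complex.abs_arg_le_pi z) (abs_nonneg _)
  have h3 := mul_le_mul_of_nonneg_left (log_norm_bounds hz) hε.le
  linarith

/-- Up to the decay in ε, the left side is |x|⁻¹ y⁻¹ (|x|/|z|) (y/|z|)^a. In logarithms L, u, v of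
|z|, |x|, y, one has |u| ≤ |L| + (L - u) and likewise for v. The gains (L - u) and a(L - v) absorb
the δ-multiples of L - u and L - v, and ε|L| absorbs 2δ|L|. The resulting bound is a product of
functions of x and y, so no polar coordinates are needed. -/
theorem weighted_power_le {a ε : ℝ} {z : ℂ} (hz : z ∈ upperHalfPlane)
    (hre : z.re ≠ 0) {δ : ℝ} (hδ0 : 0 < δ) (hδ1 : δ ≤ 1) (hδa : δ ≤ a) (hδε : δ ≤ ε / 2) :
    z.im ^ (a - 1) * Real.exp (-(a + 1) * Real.log ‖z‖ - ε * |Real.log ‖z‖|) ≤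
      logDecay δ z.re * logDecay δ z.im := by
  have hz' : 0 < z.im := hz
  rw [Real.rpow_def_of_pos hz', logDecay, logDecay, ← Real.exp_add, ← Real.exp_add,
    Real.exp_le_exp]
  have hu : Real.log z.re ≤ Real.log ‖z‖ := by
    rw [← Real.log_abs z.re]
    exact Real.log_le_log (abs_pos.2 hre) (Complex.abs_re_le_norm z)
  have hv : Real.log z.im ≤ Real.log ‖z‖ :=
    Real.log_le_log hz' ((le_abs_self _).trans (Complex.abs_im_le_norm z))
  set L := Real.log ‖z‖
  set u := Real.log z.re
  set v := Real.log z.im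
  have hL := abs_nonneg L
  have h1 : |u| ≤ |L| + (L - u) := by
    rcases abs_cases L with ⟨h, _⟩ | ⟨h, _⟩ <;> rcases abs_cases u with ⟨h', _⟩ | ⟨h', _⟩ <;>
      rw [h, h'] <;> linarith
  have h2 : |v| ≤ |L| + (L - v) := by
    rcases abs_cases L with ⟨h, _⟩ | ⟨h, _⟩ <;> rcases abs_cases v with ⟨h', _⟩ | ⟨h', _⟩ <;>
      rw [h, h'] <;> linarith
  have h3 := mul_le_mul_of_nonneg_left h1 hδ0.le
  have h4 := mul_le_mul_of_nonneg_left h2 hδ0.le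
  have h5 : δ * (L - u) ≤ 1 * (L - u) := mul_le_mul_of_nonneg_right hδ1 (by linarith)
  have h6 : δ * (L - v) ≤ a * (L - v) := mul_le_mul_of_nonneg_right hδa (by linarith)
  have h7 : δ * |L| ≤ ε / 2 * |L| := mul_le_mul_of_nonneg_right hδε hL
  linarith

theorem measurable_approxEigenfunction (a p ξ ε : ℝ) :
    Measurable (approxEigenfunction a p ξ ε) := by
  refine Measurable.indicator ?_ isOpen_upperHalfPlane.measurableSet
  fun_prop

theorem memLp_approxEigenfunction {a p : ℝ} (ha : 0 < a) (hp : 1 ≤ p) (ξ : ℝ) {ε : ℝ}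
    (hε : 0 < ε) :
    MemLp (approxEigenfunction a p ξ ε) (ENNReal.ofReal p) (areaMeasure a) := by
  have hp0 : 0 < p := by linarith
  have hm := measurable_approxEigenfunction a p ξ ε
  refine ⟨hm.aestronglyMeasurable, ?_⟩
  rw [eLpNorm_lt_top_iff_lintegral_rpow_enorm_lt_top (by simpa using hp0) ENNReal.ofReal_ne_top,
    ENNReal.toReal_ofReal hp0.le, lintegral_areaMeasure a (hm.enorm.pow_const p)]
  -- These are the three constraints of `weighted_power_le`, with εp in place of ε after taking p-th
  -- powers. Positivity of a makes δ > 0.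
  set δ : ℝ := min (min 1 a) (ε * p / 2) with hδ
  have hδ0 : 0 < δ := by positivity
  have hδ1 : δ ≤ 1 := (min_le_left _ _).trans (min_le_left _ _)
  have hδa : δ ≤ a := (min_le_left _ _).trans (min_le_right _ _)
  have hδε : δ ≤ ε * p / 2 := min_le_right _ _
  set M : ℝ := Real.exp (|ξ| * Real.pi) ^ p with hM
  have hint : Integrable fun z : ℂ => M * (logDecay δ z.re * logDecay δ z.im) :=
    (integrable_logDecay_re_mul_im hδ0).const_mul M
  refine lt_of_le_of_lt ?_ ((hint.restrict (s := upperHalfPlane)).lintegral_lt_top)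
  refine lintegral_mono_ae ?_
  filter_upwards [ae_restrict_mem isOpen_upperHalfPlane.measurableSet,
    ae_restrict_of_ae ae_re_ne_zero] with z hz hre
  have h1 := norm_approxEigenfunction_le a p ξ hε hz
  have h2 : ‖approxEigenfunction a p ξ ε z‖ ^ p ≤
      M * Real.exp (-(a + 1) * Real.log ‖z‖ - ε * p * |Real.log ‖z‖|) := by
    refine (Real.rpow_le_rpow (norm_nonneg _) h1 hp0.le).trans_eq ?_
    rw [Real.mul_rpow (Real.exp_pos _).le (Real.exp_pos _).le, ← Real.exp_mul (_ - _)]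
    congr 2
    field_simp
  rw [← ofReal_norm, ENNReal.ofReal_rpow_of_nonneg (norm_nonneg _) hp0.le,
    ← ENNReal.ofReal_mul (Real.rpow_nonneg (le_of_lt hz) _)]
  refine ENNReal.ofReal_le_ofReal ?_
  refine (mul_le_mul_of_nonneg_left h2 (Real.rpow_nonneg (le_of_lt hz) _)).trans ?_
  rw [mul_left_comm]
  exact mul_le_mul_of_nonneg_left
    (weighted_power_le hz hre hδ0 hδ1 hδa hδε) (by positivity)

/-- The real part is controlled by comparing |z + i| and |e^{-s}z + i| in both directions. Each of
the two arguments contributes at most π. The bound is uniform in z. -/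
theorem norm_log_add_I_sub_le (s : ℝ) {z : ℂ} (hz : z ∈ upperHalfPlane) :
    ‖Complex.log (z + Complex.I) - Complex.log ((Real.exp (-s) : ℂ) * z + Complex.I)‖
      ≤ |s| + 2 * Real.pi := by
  set w : ℂ := (Real.exp (-s) : ℂ) * z with hw
  have hwU : w ∈ upperHalfPlane := (mul_mem_upperHalfPlane_iff (Real.exp_pos _) z).2 hz
  have hz0 : 0 < ‖z + Complex.I‖ :=
    norm_pos_iff.2 (ne_zero_of_mem_upperHalfPlane (add_I_mem_upperHalfPlane hz))
  have hw0 : 0 < ‖w + Complex.I‖ :=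
    norm_pos_iff.2 (ne_zero_of_mem_upperHalfPlane (add_I_mem_upperHalfPlane hwU))
  have h1 : ‖w + Complex.I‖ ≤ Real.exp |s| * ‖z + Complex.I‖ := by
    have h3 := norm_mul_add_I_le (Real.exp_pos (-s)) hz
    rwa [Real.log_exp, abs_neg] at h3
  have h2 : ‖z + Complex.I‖ ≤ Real.exp |s| * ‖w + Complex.I‖ := by
    have h3 := norm_mul_add_I_le (Real.exp_pos s) hwU
    have h4 : (Real.exp s : ℂ) * w = z := by
      rw [hw, ← mul_assoc, ← Complex.ofReal_mul, ← Real.exp_add]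
      simp
    rwa [h4, Real.log_exp] at h3
  have h5 := Real.log_le_log hw0 h1
  have h6 := Real.log_le_log hz0 h2
  rw [Real.log_mul (Real.exp_pos _).ne' hz0.ne', Real.log_exp] at h5
  rw [Real.log_mul (Real.exp_pos _).ne' hw0.ne', Real.log_exp] at h6
  refine (Complex.norm_le_abs_re_add_abs_im _).trans (add_le_add ?_ ?_)
  · rw [Complex.sub_re, Complex.log_re, Complex.log_re, abs_le]
    constructor <;> linarith
  · rw [Complex.sub_im, Complex.log_im, Complex.log_im]
    refine (abs_sub _ _).trans ?_
    linarith [Complex.abs_arg_le_pi (z + Complex.I), Complex.abs_arg_le_pi (w + Complex.I)]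

theorem dilate_approxEigenfunction (a p ξ ε s : ℝ) {z : ℂ} (hz : z ∈ upperHalfPlane) :
    dilate a p s (approxEigenfunction a p ξ ε) z =
      Complex.exp (-Complex.I * ξ * s) * approxEigenfunction a p ξ ε z *
        Complex.exp (ε * (-s + 2 * (Complex.log (z + Complex.I) -
          Complex.log ((Real.exp (-s) : ℂ) * z + Complex.I)))) := by
  have hwU := (mul_mem_upperHalfPlane_iff (Real.exp_pos (-s)) z).2 hz
  rw [dilate, approxEigenfunction, indicator_of_mem hz, indicator_of_mem hwU,
    Complex.ofReal_exp (-s * _), ← Complex.exp_add, ← Complex.exp_add, ← Complex.exp_add,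
    Complex.log_ofReal_mul (Real.exp_pos _) (ne_zero_of_mem_upperHalfPlane hz), Real.log_exp]
  congr 1
  push_cast
  ring

theorem norm_dilate_approxEigenfunction_sub_le (a p ξ : ℝ) {ε s : ℝ} (hε : 0 < ε)
    (hs : ε * (3 * |s| + 4 * Real.pi) ≤ 1) (z : ℂ) :
    ‖dilate a p s (approxEigenfunction a p ξ ε) z -
      Complex.exp (-Complex.I * ξ * s) * approxEigenfunction a p ξ ε z‖ ≤
      2 * (ε * (3 * |s| + 4 * Real.pi)) * ‖approxEigenfunction a p ξ ε z‖ := by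
  by_cases hz : z ∈ upperHalfPlane
  · rw [dilate_approxEigenfunction a p ξ ε s hz]
    set q : ℂ := ε * (-s + 2 * (Complex.log (z + Complex.I) -
          Complex.log ((Real.exp (-s) : ℂ) * z + Complex.I))) with hq
    have h1 : ‖q‖ ≤ ε * (3 * |s| + 4 * Real.pi) := by
      rw [hq, norm_mul, Complex.norm_real, Real.norm_eq_abs, abs_of_pos hε]
      -- The constant is |s| + 2(|s| + 2π) = 3|s| + 4π.
      refine mul_le_mul_of_nonneg_left ?_ hε.le
      refine (norm_add_le _ _).trans ?_
      rw [norm_neg, Complex.norm_real, Real.norm_eq_abs, norm_mul, Complex.norm_two]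
      linarith [norm_log_add_I_sub_le s hz]
    have h2 := Complex.norm_exp_sub_one_le (h1.trans hs)
    have h3 : ‖Complex.exp (-Complex.I * ξ * s)‖ = 1 := by
      rw [Complex.norm_exp]
      simp
    rw [← mul_sub_one, norm_mul, norm_mul, h3, one_mul, mul_comm]
    refine mul_le_mul_of_nonneg_right ?_ (norm_nonneg _)
    linarith
  · have hw := mt (mul_mem_upperHalfPlane_iff (Real.exp_pos (-s)) z).1 hz
    rw [dilate, approxEigenfunction, indicator_of_notMem hz, indicator_of_notMem hw]
    simp

section

variable {a p : ℝ} [hp : Fact (1 ≤ p)]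

theorem BergmanSpace.norm_le_mul_norm (f g : BergmanSpace a p) {c : ℝ}
    (h : ∀ z, ‖f z‖ ≤ c * ‖g z‖) : ‖f‖ ≤ c * ‖g‖ := by
  rw [← (toLebesgue a p).norm_map f, ← (toLebesgue a p).norm_map g]
  refine Lp.norm_le_mul_norm_of_ae_le_mul ?_
  filter_upwards [f.coeFn_toLebesgue, g.coeFn_toLebesgue] with z hf hg
  rw [hf, hg]
  exact h z

theorem exists_approximate_eigenvectors (ha : 0 < a) (ξ : ℝ) :
    ∃ f : ℕ → BergmanSpace a p, (∀ n, ‖f n‖ = 1) ∧ ∀ s : ℝ, Tendsto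
      (fun n => ‖bergmanDilation a p s (f n) - Complex.exp (-Complex.I * ξ * s) • f n‖)
      atTop (𝓝 0) := by
  let ε : ℕ → ℝ := fun n => 1 / ((n : ℝ) + 1)
  have hε : ∀ n, 0 < ε n := fun n => Nat.one_div_pos_of_nat
  have hεlim : Tendsto ε atTop (𝓝 0) := tendsto_one_div_add_atTop_nhds_zero_nat
  let g : ℕ → BergmanSpace a p := fun n =>
    (⟨approxEigenfunction a p ξ (ε n), differentiableOn_approxEigenfunction a p ξ (ε n),
      fun z hz => indicator_of_notMem hz _, memLp_approxEigenfunction ha hp.out ξ (hε n)⟩ :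
      bergmanSubmodule a p)
  have hg : ∀ n, g n ≠ 0 := by
    intro n hn
    have h1 : approxEigenfunction a p ξ (ε n) Complex.I = 0 :=
      congrFun (congrArg Subtype.val hn) Complex.I
    have hI : Complex.I ∈ upperHalfPlane := by simp [upperHalfPlane]
    rw [approxEigenfunction, indicator_of_mem hI] at h1
    exact Complex.exp_ne_zero _ h1
  have hgn : ∀ n, ‖g n‖ ≠ 0 := fun n => norm_ne_zero_iff.2 (hg n)
  refine ⟨fun n => ((‖g n‖ : ℂ)⁻¹) • g n, fun n => ?_, fun s => ?_⟩
  · rw [norm_smul, norm_inv, Complex.norm_real, norm_norm, inv_mul_cancel₀ (hgn n)]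
  · have hlim : Tendsto (fun n => ε n * (3 * |s| + 4 * Real.pi)) atTop (𝓝 0) := by
      simpa using hεlim.mul_const (3 * |s| + 4 * Real.pi)
    have hlim2 : Tendsto (fun n => 2 * (ε n * (3 * |s| + 4 * Real.pi))) atTop (𝓝 0) := by
      simpa using hlim.const_mul 2
    refine squeeze_zero' (Eventually.of_forall fun _ => norm_nonneg _) ?_ hlim2
    -- The estimate |e^q - 1| ≤ 2|q| requires |q| ≤ 1, which holds once ε_n is small for the given
    -- s.
    filter_upwards [hlim.eventually_le_const one_pos] with n hn
    have h2 : ‖bergmanDilation a p s (g n) - Complex.exp (-Complex.I * ξ * s) • g n‖ ≤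
        2 * (ε n * (3 * |s| + 4 * Real.pi)) * ‖g n‖ :=
      BergmanSpace.norm_le_mul_norm _ _
        (norm_dilate_approxEigenfunction_sub_le a p ξ (hε n) hn)
    rw [ContinuousLinearMap.map_smul, smul_comm, ← smul_sub, norm_smul, norm_inv,
      Complex.norm_real, norm_norm, inv_mul_le_iff₀ (lt_of_le_of_ne (norm_nonneg _) (hgn n).symm),
      mul_comm ‖g n‖]
    exact h2

end

/-! ### Logarithmic variables -/

section ChangeOfVariables

variable {E : Type*} [NormedAddCommGroup E] [NormedSpace ℝ E]

theorem integrableOn_Ioi_iff_integrable_comp_exp (g : ℝ → E) :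
    IntegrableOn g (Ioi 0) ↔ Integrable fun s => Real.exp s • g (Real.exp s) := by
  have h := integrableOn_image_iff_integrableOn_abs_deriv_smul MeasurableSet.univ
    (fun x _ => (Real.hasDerivAt_exp x).hasDerivWithinAt) Real.exp_injective.injOn g
  rw [image_univ, Real.range_exp, integrableOn_univ] at h
  simpa only [abs_of_pos (Real.exp_pos _)] using h

theorem integral_Ioi_eq_integral_comp_exp (g : ℝ → E) :
    ∫ t in Ioi 0, g t = ∫ s, Real.exp s • g (Real.exp s) := by
  have h := integral_image_eq_integral_abs_deriv_smul MeasurableSet.univ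
    (fun x _ => (Real.hasDerivAt_exp x).hasDerivWithinAt) Real.exp_injective.injOn g
  rw [image_univ, Real.range_exp, setIntegral_univ] at h
  simpa only [abs_of_pos (Real.exp_pos _)] using h

end ChangeOfVariables

/-- The kernel of the Hausdorff operator in the variable `s = log t`. -/
def logKernel (φ : ℝ → ℂ) (a p s : ℝ) : ℂ :=
  φ (Real.exp s) * (Real.exp (s * ((a + 1) / p)) : ℝ)

theorem integrable_logKernel {φ : ℝ → ℂ} {a p : ℝ}
    (hφ : AEMeasurable φ (volume.restrict (Ioi (0 : ℝ))))
    (hint : IntegrableOn (fun t : ℝ => ‖φ t‖ * t ^ ((a + 1) / p - 1)) (Ioi 0)) :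
    Integrable (logKernel φ a p) := by
  have h1 : IntegrableOn (fun t : ℝ => φ t * ((t ^ ((a + 1) / p - 1) : ℝ) : ℂ)) (Ioi 0) := by
    have hm : AEStronglyMeasurable (fun t : ℝ => φ t * ((t ^ ((a + 1) / p - 1) : ℝ) : ℂ))
        (volume.restrict (Ioi 0)) := by
      refine hφ.aestronglyMeasurable.mul (Measurable.aestronglyMeasurable ?_)
      fun_prop
    refine (integrable_norm_iff hm).1 (Integrable.congr hint ?_)
    filter_upwards [ae_restrict_mem measurableSet_Ioi] with t ht
    rw [norm_mul, Complex.norm_real, Real.norm_eq_abs, abs_of_nonneg (Real.rpow_nonneg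
      (le_of_lt ht) _)]
  refine ((integrableOn_Ioi_iff_integrable_comp_exp _).1 h1).congr
    (Eventually.of_forall fun s => ?_)
  simp only [logKernel, Complex.real_smul]
  rw [← Real.exp_mul, mul_left_comm, ← Complex.ofReal_mul, ← Real.exp_add]
  congr 3
  ring

theorem kernelTransform_eq (φ : ℝ → ℂ) (a p ξ : ℝ) :
    kernelTransform φ a p ξ
      = ∫ s, logKernel φ a p s * Complex.exp (-Complex.I * ξ * s) := by
  rw [kernelTransform, integral_Ioi_eq_integral_comp_exp]
  refine integral_congr_ae (Eventually.of_forall fun s => ?_)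
  have h0 : (Real.exp s : ℂ) ≠ 0 := Complex.ofReal_ne_zero.2 (Real.exp_pos s).ne'
  simp only [logKernel, Complex.real_smul]
  rw [Complex.cpow_def_of_ne_zero h0, ← Complex.ofReal_log (Real.exp_pos s).le, Real.log_exp,
    ← Real.exp_mul, mul_add, mul_one, Complex.exp_add, ← Complex.ofReal_exp,
    show -Complex.I * ξ * s = -((s : ℂ) * (Complex.I * ξ)) by ring, Complex.exp_neg]
  field_simp

/-- The Jacobian e^s cancels the 1/t of the integrand, and the powers e^{±s(a+1)/p} put into the
kernel and into the dilation cancel each other. -/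
theorem exp_smul_hausdorffIntegrand (φ : ℝ → ℂ) (a p : ℝ) (f : ℂ → ℂ) (z : ℂ) (s : ℝ) :
    Real.exp s • hausdorffIntegrand φ f z (Real.exp s)
      = logKernel φ a p s * dilate a p s f z := by
  have h0 : (Real.exp s : ℂ) ≠ 0 := Complex.ofReal_ne_zero.2 (Real.exp_pos s).ne'
  have h1 : z / (Real.exp s : ℂ) = (Real.exp (-s) : ℂ) * z := by
    rw [Real.exp_neg, Complex.ofReal_inv, div_eq_inv_mul]
  have h2 : ((Real.exp (s * ((a + 1) / p)) : ℝ) : ℂ) * (Real.exp (-s * ((a + 1) / p)) : ℝ) = 1 := by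
    rw [← Complex.ofReal_mul, ← Real.exp_add]
    simp
  rw [hausdorffIntegrand, logKernel, dilate, h1, Complex.real_smul]
  calc _ = φ (Real.exp s) * f ((Real.exp (-s) : ℂ) * z) := by field_simp
    _ = φ (Real.exp s) * f ((Real.exp (-s) : ℂ) * z) *
        (((Real.exp (s * ((a + 1) / p)) : ℝ) : ℂ) * (Real.exp (-s * ((a + 1) / p)) : ℝ)) := by
      rw [h2, mul_one]
    _ = _ := by ring

theorem integrableOn_hausdorffIntegrand_iff (φ : ℝ → ℂ) (a p : ℝ) (f : ℂ → ℂ) (z : ℂ) :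
    IntegrableOn (hausdorffIntegrand φ f z) (Ioi 0) ↔
      Integrable fun s => logKernel φ a p s * dilate a p s f z := by
  rw [integrableOn_Ioi_iff_integrable_comp_exp]
  simp_rw [exp_smul_hausdorffIntegrand φ a p f z]

theorem integral_hausdorffIntegrand (φ : ℝ → ℂ) (a p : ℝ) (f : ℂ → ℂ) (z : ℂ) :
    ∫ t in Ioi 0, hausdorffIntegrand φ f z t
      = ∫ s, logKernel φ a p s * dilate a p s f z := by
  rw [integral_Ioi_eq_integral_comp_exp]
  simp_rw [exp_smul_hausdorffIntegrand φ a p f z]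

/-! ### The averages as pointwise Hausdorff integrals -/

theorem lintegral_restrict_le_eLpNorm {a p : ℝ} {f : ℂ → ℂ}
    (hf : AEStronglyMeasurable f (areaMeasure a)) {B : Set ℂ} (hp1 : 1 ≤ p) :
    ∫⁻ z in B, ‖f z‖ₑ ∂(areaMeasure a) ≤
      eLpNorm f (ENNReal.ofReal p) (areaMeasure a) * areaMeasure a B ^ (1 - 1 / p) := by
  have h1 := eLpNorm_le_eLpNorm_mul_rpow_measure_univ (μ := (areaMeasure a).restrict B) (f := f)
    (p := 1) (q := ENNReal.ofReal p) (by simpa using ENNReal.ofReal_le_ofReal hp1)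
    hf.restrict
  rw [eLpNorm_one_eq_lintegral_enorm, Measure.restrict_apply_univ, ENNReal.toReal_one,
    ENNReal.toReal_ofReal (by linarith), div_one] at h1
  refine h1.trans ?_
  gcongr
  exact Measure.restrict_le_self

theorem measure_rpow_ne_top {a p : ℝ} (hp1 : 1 ≤ p) {B : Set ℂ} (hB : areaMeasure a B < ⊤) :
    areaMeasure a B ^ (1 - 1 / p) ≠ ⊤ :=
  ENNReal.rpow_ne_top_of_nonneg
    (sub_nonneg.2 ((div_le_one (by linarith)).2 hp1)) hB.ne

variable {a p : ℝ} [hp : Fact (1 ≤ p)]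

/-- Point evaluation is a bounded functional, so it commutes with the vector-valued integral and
carries its absolute convergence to every z. -/
theorem isHausdorffOnBergman_average {φ : ℝ → ℂ} (hk : Integrable (logKernel φ a p)) :
    IsHausdorffOnBergman φ
      ((isContractionGroup_bergmanDilation (a := a) (p := p)).average hk) := by
  intro f z hz
  have h1 := (isContractionGroup_bergmanDilation (a := a) (p := p)).integrable_smul hk f
  rw [integrableOn_hausdorffIntegrand_iff φ a p, integral_hausdorffIntegrand φ a p]
  refine ⟨(BergmanSpace.eval hz).integrable_comp h1, ?_⟩
  rw [← BergmanSpace.eval_apply hz, IsContractionGroup.map_average_apply]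
  rfl

/-- Integration over a set of finite measure, as a functional on `L^p_a`. -/
def setIntegralFunctional (a p : ℝ) [hp : Fact (1 ≤ p)] {B : Set ℂ} (hB : areaMeasure a B < ⊤) :
    LebesgueSpace a p →L[ℂ] ℂ :=
  have hint : ∀ f : LebesgueSpace a p, IntegrableOn f B (areaMeasure a) := fun f =>
    ⟨(Lp.aestronglyMeasurable f).restrict, lt_of_le_of_lt
      (lintegral_restrict_le_eLpNorm (Lp.aestronglyMeasurable f) hp.out)
      (ENNReal.mul_lt_top (Lp.eLpNorm_lt_top f) (measure_rpow_ne_top hp.out hB).lt_top)⟩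
  LinearMap.mkContinuous
    { toFun := fun f => ∫ z in B, f z ∂(areaMeasure a)
      map_add' := fun f g => by
        rw [← integral_add (hint f) (hint g)]
        exact integral_congr_ae (ae_restrict_of_ae (Lp.coeFn_add f g))
      map_smul' := fun c f => by
        rw [RingHom.id_apply, ← integral_smul]
        exact integral_congr_ae (ae_restrict_of_ae (Lp.coeFn_smul c f)) }
    (areaMeasure a B ^ (1 - 1 / p)).toReal fun f => by
      rw [mul_comm, Lp.norm_def, ← ENNReal.toReal_mul, ← toReal_enorm]
      exact ENNReal.toReal_mono
        (ENNReal.mul_ne_top (Lp.eLpNorm_ne_top f) (measure_rpow_ne_top hp.out hB))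
        ((enorm_integral_le_lintegral_enorm _).trans
          (lintegral_restrict_le_eLpNorm (Lp.aestronglyMeasurable f) hp.out))

theorem setIntegralFunctional_apply {B : Set ℂ} (hB : areaMeasure a B < ⊤)
    (f : LebesgueSpace a p) :
    setIntegralFunctional a p hB f = ∫ z in B, f z ∂(areaMeasure a) := rfl

/-- By Hölder and the isometry of the dilations, ∫_B |U_s f| is bounded independently of s, and k is
integrable. -/
theorem integrable_prod_dilate {k : ℝ → ℂ} (hk : Integrable k) (f : LebesgueSpace a p)
    {B : Set ℂ} (hB : areaMeasure a B < ⊤) :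
    Integrable (fun q : ℝ × ℂ => k q.1 * dilate a p q.1 f q.2)
      (volume.prod ((areaMeasure a).restrict B)) := by
  have hm : AEStronglyMeasurable (fun q : ℝ × ℂ => k q.1 * dilate a p q.1 f q.2)
      (volume.prod ((areaMeasure a).restrict B)) :=
    hk.aestronglyMeasurable.comp_fst.mul
      (measurable_uncurry_dilate a p (Lp.stronglyMeasurable f).measurable).aestronglyMeasurable
  refine ⟨hm, ?_⟩
  rw [HasFiniteIntegral, lintegral_prod _ hm.enorm]
  set c : ENNReal := eLpNorm f (ENNReal.ofReal p) (areaMeasure a) *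
    areaMeasure a B ^ (1 - 1 / p) with hc
  have hctop : c ≠ ⊤ :=
    ENNReal.mul_ne_top (Lp.eLpNorm_ne_top f) (measure_rpow_ne_top hp.out hB)
  calc ∫⁻ s, ∫⁻ z in B, ‖k s * dilate a p s f z‖ₑ ∂(areaMeasure a)
      ≤ ∫⁻ s, ‖k s‖ₑ * c := by
        refine lintegral_mono fun s => ?_
        simp_rw [enorm_mul]
        rw [lintegral_const_mul' _ _ enorm_ne_top]
        gcongr
        rw [hc, ← eLpNorm_dilate hp.out s (Lp.aestronglyMeasurable f)]
        exact lintegral_restrict_le_eLpNorm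
          (aestronglyMeasurable_dilate p s (Lp.aestronglyMeasurable f)) hp.out
    _ < ⊤ := by
        rw [lintegral_mul_const' _ _ hctop]
        exact ENNReal.mul_lt_top hk.2 hctop.lt_top

/-- Point evaluations are not available on L^p_a. Instead both sides are integrated over sets of
finite measure, where Fubini applies. The measure is σ-finite, so this determines them almost
everywhere. -/
theorem isHausdorffOnLebesgue_average {φ : ℝ → ℂ} (hk : Integrable (logKernel φ a p)) :
    IsHausdorffOnLebesgue φ
      ((isContractionGroup_lebesgueDilation (a := a) (p := p)).average hk) := by
  intro f
  set k := logKernel φ a p with hk_def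
  set S := (isContractionGroup_lebesgueDilation (a := a) (p := p)).average hk with hS
  have hae : ∀ᵐ z ∂(areaMeasure a), Integrable fun s => k s * dilate a p s f z := by
    refine ae_of_forall_measure_lt_top_ae_restrict _ fun B _ hB => ?_
    exact (integrable_prod_dilate hk f hB).prod_left_ae
  have heq : (S f : ℂ → ℂ) =ᵐ[areaMeasure a] fun z => ∫ s, k s * dilate a p s f z := by
    refine ae_eq_of_forall_setIntegral_eq_of_sigmaFinite (fun B _ hB => ?_) (fun B _ hB => ?_)
      fun B _ hB => ?_
    · exact ⟨(Lp.aestronglyMeasurable _).restrict, lt_of_le_of_lt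
        (lintegral_restrict_le_eLpNorm (Lp.aestronglyMeasurable _) hp.out)
        (ENNReal.mul_lt_top (Lp.eLpNorm_lt_top _) (measure_rpow_ne_top hp.out hB).lt_top)⟩
    · exact (integrable_prod_dilate hk f hB).integral_prod_right
    · rw [← setIntegralFunctional_apply hB, hS, IsContractionGroup.map_average_apply,
        ← integral_integral_swap (f := fun s z => k s * dilate a p s f z)
          (integrable_prod_dilate hk f hB)]
      refine integral_congr_ae (Eventually.of_forall fun s => ?_)
      simp only [setIntegralFunctional_apply, smul_eq_mul]
      rw [integral_const_mul]
      congr 1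
      exact integral_congr_ae (ae_restrict_of_ae (coeFn_lebesgueDilation s f))
  filter_upwards [hae, heq] with z h1 h2
  rw [integrableOn_hausdorffIntegrand_iff φ a p, integral_hausdorffIntegrand φ a p]
  exact ⟨h1, h2⟩

end HausdorffBergman
end

theorem theorem2 (p a : ℝ) [Fact (1 ≤ p)] (ha : 0 < a) (φ : ℝ → ℂ)
    (hφ : AEMeasurable φ (volume.restrict (Ioi (0 : ℝ))))
    (hint : IntegrableOn (fun t : ℝ => ‖φ t‖ * t ^ ((a + 1) / p - 1)) (Ioi 0)) :
    (∃ T : HausdorffBergman.BergmanSpace a p →L[ℂ] HausdorffBergman.BergmanSpace a p,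
      HausdorffBergman.IsHausdorffOnBergman φ T ∧
      spectrum ℂ T = closure (range (HausdorffBergman.kernelTransform φ a p))) ∧
    (∃ S : HausdorffBergman.LebesgueSpace a p →L[ℂ] HausdorffBergman.LebesgueSpace a p,
      HausdorffBergman.IsHausdorffOnLebesgue φ S ∧
      spectrum ℂ S = closure (range (HausdorffBergman.kernelTransform φ a p))) := by
  have hk := HausdorffBergman.integrable_logKernel (a := a) (p := p) hφ hint
  have htransform : HausdorffBergman.kernelTransform φ a p = fun ξ : ℝ =>
      ∫ s, HausdorffBergman.logKernel φ a p s * Complex.exp (-Complex.I * ξ * s) :=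
    funext (HausdorffBergman.kernelTransform_eq φ a p)
  rw [htransform]
  refine ⟨⟨_, HausdorffBergman.isHausdorffOnBergman_average hk,
    HausdorffBergman.IsContractionGroup.spectrum_average_eq _ hk
      (HausdorffBergman.exists_approximate_eigenvectors ha)⟩,
    ⟨_, HausdorffBergman.isHausdorffOnLebesgue_average hk,
    HausdorffBergman.IsContractionGroup.spectrum_average_eq _ hk fun ξ => ?_⟩⟩
  -- The holomorphic approximate eigenvectors also serve L^p_a, since the isometric inclusion
  -- intertwines the two dilation groups.
  obtain ⟨f, hf1, hf⟩ := HausdorffBergman.exists_approximate_eigenvectors (p := p) ha ξ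
  refine ⟨fun n => HausdorffBergman.BergmanSpace.toLebesgue a p (f n), fun n => ?_, fun s => ?_⟩
  · rw [LinearIsometry.norm_map, hf1]
  · refine (hf s).congr fun n => ?_
    rw [← HausdorffBergman.toLebesgue_bergmanDilation, ← LinearIsometry.map_smul,
      ← LinearIsometry.map_sub, LinearIsometry.norm_map]
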